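/- Let $\mathbb K\in\{\mathbb R,\mathbb C\}$. Lie groups are modelled on (Hausdorff) locally convex $\mathbb K$-vector spaces, and smoothness is understood in the sense of Michal--Bastiani ($f$ is $C^1$ if it is continuous and all directional derivatives exist and define a continuous map $(x,h)\mapsto df(x)(h)$; $f$ is $C^n$ if moreover $df$ is $C^{n-1}$; smooth means $C^n$ for all $n$). **Definitions.** A subgroup $H$ of a Lie group $G$ is a *split Lie subgroup* if it carries a Lie group structure and $G/H$ a manifold structure for which $H\hookrightarrow G$ is a morphism of Lie groups and $G\to G/H$ is a smooth $H$-principal bundle. An *extension of Lie groups* $N\to\widehat G\xrightarrow{q}G$ is a short exact sequence of Lie group morphisms which makes $\widehat G$ a smooth $N$-principal bundle over $G$ (so that $G\cong\widehat G/N$); two extensions of $G$ by $N$ are *equivalent* if there is a Lie group morphism between the total groups inducing the identity on $N$ and on $G$. For an extension let $C_N:\widehat G\to\mathrm{Aut}(N)$ be the conjugation action, and for $n\in N$ write also $C_N(n)$ for the inner automorphism. $C^1_s(G,N)$ is the set of maps $f:G\to N$ with $f(1)=1$ which are smooth on an identity neighbourhood. $C^2_{ss}(G,N)$ is the set of maps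 $\omega:G\times G\to N$ with $\omega(g,1)=\omega(1,g)=1$ which are smooth on an identity neighbourhood and for which each map $x\mapsto\omega(g,x)\,\omega(gxg^{-1},g)^{-1}$ is smooth on an identity neighbourhood. A *strongly smooth outer action* of $G$ on $N$ is a map $S$ from $G$ to the group $\mathrm{Aut}(N)$ of Lie group automorphisms with $S(1)=\mathrm{id}$, such that $(g,n)\mapsto S(g)(n)$ is smooth on $U\times N$ for an identity neighbourhood $U\subseteq G$, and such that $\delta_S(g,g'):=S(g)S(g')S(gg')^{-1}=C_N(\omega(g,g'))$ for some $\omega\in C^2_{ss}(G,N)$. Write $S\sim S'$ if $S'=(C_N\circ h)\cdot S$ for some $h\in C^1_s(G,N)$, and $[S]$ for the class of $S$. An extension $q:\widehat G\to G$ of $G$ by $N$ *corresponds to* $[S]$ if $C_N\circ\sigma\sim S$ for a normalized section $\sigma:G\to\widehat G$ of $q$ that is smooth on an identity neighbourhood; $\mathrm{Ext}(G,N)_{[S]}$ is the set of equivalence classes of these extensions. **Setting.** Let $G,N$ be Lie groups such that the center $Z(N)$ is a split Lie subgroup of $N$, let $N_{\rm ad}:=N/Z(N)\cong C_N(N)\subseteq\mathrm{Aut}(N)$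 with its quotient structure, and let $S$ be a strongly smooth outer action of $G$ on $N$. Let $G^S$ be the group $N_{\rm ad}\times G$ with the product $$(C_N(n),g)(C_N(n'),g')=\bigl(C_N(n)\,S(g)C_N(n')S(g)^{-1}\,\delta_S(g,g'),\,gg'\bigr),$$ let $q_S:G^S\to G$ be the projection, and let $\rho:G^S\to\mathrm{Aut}(N)$, $\rho(C_N(n),g)=C_N(n)S(g)$. **Proposition.** The group $G^S$ carries a natural Lie group structure, i.e. one for which, for some open identity neighbourhood $U\subseteq G$, the identity map $N_{\rm ad}\times U\to q_S^{-1}(U)$ is a diffeomorphism onto an open subset of $G^S$. With respect to it, $\rho$ turns $Z(N)$ into a smooth $G^S$-module, and the following holds. Let $q:\widehat G\to G$ be a Lie group extension of $G$ by $N$ corresponding to $[S]$. Then the map $$\gamma=(C_N\cdot(S\circ q)^{-1},q):\widehat G\to\mathrm{Aut}(N)\times G,\qquad x\mapsto\bigl(C_N(x)S(q(x))^{-1},q(x)\bigr)$$ takes values in $G^S$ and defines a Lie group extension $Z(N)\hookrightarrow\widehat G\xrightarrow{\gamma}G^S$ for which the associated action of $G^S$ on $Z(N)$ is the one given by $\rho$;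 moreover $Z(N)$ is a split Lie subgroup of $\widehat G$, and $\gamma$ induces an isomorphism of Lie groups $\widehat G/Z(N)\cong G^S$. 1. If $q_j:\widehat G_j\to G$, $j=1,2$, are equivalent extensions of $G$ by $N$ corresponding to $[S]$, then $\gamma_j:\widehat G_j\to G^S$ are equivalent extensions of $G^S$ by $Z(N)$. Hence there is a map $\tau:\mathrm{Ext}(G,N)_{[S]}\to\mathrm{Ext}(G^S,Z(N))_{[\rho]}$ sending the class of $q$ to the class of $\gamma$. 2. Let $\gamma:\widehat G^S\to G^S$ be a Lie group extension of $G^S$ by $Z(N)$. It corresponds to the $G^S$-module structure $\rho$ on $Z(N)$ and its class lies in the image of $\tau$ if and only if there exists a $G^S$-equivariant equivalence $\alpha:N\to\gamma^{-1}(N_{\rm ad})\subseteq\widehat G^S$ of central extensions of $N_{\rm ad}$ by $Z(N)$. Here $\gamma^{-1}(N_{\rm ad})$ carries its structure of a split Lie subgroup of $\widehat G^S$, $G^S$ acts on $N$ by $\rho$, and $\gamma(x)$ acts on $\gamma^{-1}(N_{\rm ad})$ by conjugation with $x\in\widehat G^S$. -/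

import Mathlib

open scoped Topology
open Filter Set

universe u v

namespace LCLie

/-! ### Differential calculus and manifolds modelled on locally convex spaces -/

/-- `IsCn 𝕜 n f U`: on the open set `U` the map `f` between topological vector spaces is `C^n`:
it is continuous on `U`, and for `n ≥ 1` all directional derivatives
`df x h = lim_{t → 0} t⁻¹ (f (x + t h) - f x)`, `x ∈ U`, exist and `df` is `C^{n-1}` on `U × E`. -/
def IsCn (𝕜 : Type v) [RCLike 𝕜] : ℕ → ∀ {E F : Type u}
    [AddCommGroup E] [Module 𝕜 E] [TopologicalSpace E]
    [AddCommGroup F] [Module 𝕜 F] [TopologicalSpace F], (E → F) → Set E → Prop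
  | 0, _, _, _, _, _, _, _, _, f, U => ContinuousOn f U
  | n + 1, E, F, _, _, _, _, _, _, f, U =>
      ContinuousOn f U ∧ ∃ df : E × E → F,
        (∀ x ∈ U, ∀ h : E, Tendsto (fun t : 𝕜 => t⁻¹ • (f (x + t • h) - f x)) (𝓝[≠] 0)
          (𝓝 (df (x, h)))) ∧
        IsCn 𝕜 n df (U ×ˢ univ)

section Calculus

variable {𝕜 : Type v} [RCLike 𝕜] {E E' F F' : Type u}
  [AddCommGroup E] [Module 𝕜 E] [TopologicalSpace E]
  [AddCommGroup E'] [Module 𝕜 E'] [TopologicalSpace E']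
  [AddCommGroup F] [Module 𝕜 F] [TopologicalSpace F]
  [AddCommGroup F'] [Module 𝕜 F'] [TopologicalSpace F']

theorem IsCn.mono {n : ℕ} : ∀ {E F : Type u}
    [AddCommGroup E] [Module 𝕜 E] [TopologicalSpace E]
    [AddCommGroup F] [Module 𝕜 F] [TopologicalSpace F] {f : E → F} {U V : Set E},
    IsCn 𝕜 n f U → V ⊆ U → IsCn 𝕜 n f V := by
  induction n with
  | zero => intro E F _ _ _ _ _ _ f U V h hV; exact ContinuousOn.mono h hV
  | succ n ih =>
    intro E F _ _ _ _ _ _ f U V h hV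
    obtain ⟨hc, df, hd, hdf⟩ := h
    exact ⟨hc.mono hV, df, fun x hx => hd x (hV hx), ih hdf (prod_mono hV le_rfl)⟩

theorem IsCn.comp_clm {n : ℕ} : ∀ {E E' F : Type u}
    [AddCommGroup E] [Module 𝕜 E] [TopologicalSpace E]
    [AddCommGroup E'] [Module 𝕜 E'] [TopologicalSpace E']
    [AddCommGroup F] [Module 𝕜 F] [TopologicalSpace F] {f : E → F} {U : Set E}
    (A : E' →L[𝕜] E), IsCn 𝕜 n f U → IsCn 𝕜 n (fun x => f (A x)) (A ⁻¹' U) := by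
  induction n with
  | zero =>
    intro E E' F _ _ _ _ _ _ _ _ _ f U A h
    exact ContinuousOn.comp (f := A) h A.continuous.continuousOn (fun x hx => hx)
  | succ n ih =>
    intro E E' F _ _ _ _ _ _ _ _ _ f U A h
    obtain ⟨hc, df, hd, hdf⟩ := h
    refine ⟨hc.comp A.continuous.continuousOn (fun x hx => hx),
      fun p => df (A p.1, A p.2), fun x hx k => ?_, ?_⟩
    · simpa using hd (A x) hx (A k)
    · exact (ih (A.prodMap A) hdf).mono (fun p hp => ⟨hp.1, mem_univ _⟩)

theorem IsCn.prodMk {n : ℕ} : ∀ {E F F' : Type u}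
    [AddCommGroup E] [Module 𝕜 E] [TopologicalSpace E]
    [AddCommGroup F] [Module 𝕜 F] [TopologicalSpace F]
    [AddCommGroup F'] [Module 𝕜 F'] [TopologicalSpace F'] {f : E → F} {g : E → F'} {U : Set E},
    IsCn 𝕜 n f U → IsCn 𝕜 n g U → IsCn 𝕜 n (fun x => (f x, g x)) U := by
  induction n with
  | zero =>
    intro E F F' _ _ _ _ _ _ _ _ _ f g U hf hg
    exact ContinuousOn.prodMk hf hg
  | succ n ih =>
    intro E F F' _ _ _ _ _ _ _ _ _ f g U hf hg
    obtain ⟨hc, df, hd, hdf⟩ := hf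
    obtain ⟨hc', dg, hd', hdg⟩ := hg
    exact ⟨hc.prodMk hc', fun p => (df p, dg p),
      fun x hx k => (hd x hx k).prodMk_nhds (hd' x hx k), ih hdf hdg⟩

theorem IsCn.prodMap {n : ℕ} {f : E → F} {g : E' → F'} {U : Set E} {V : Set E'}
    (hf : IsCn 𝕜 n f U) (hg : IsCn 𝕜 n g V) : IsCn 𝕜 n (Prod.map f g) (U ×ˢ V) :=
  ((hf.comp_clm (ContinuousLinearMap.fst 𝕜 E E')).mono fun _ h => h.1).prodMk
    ((hg.comp_clm (ContinuousLinearMap.snd 𝕜 E E')).mono fun _ h => h.2)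

end Calculus

/-- The structure of a smooth `𝕜`-manifold modelled on a (Hausdorff) locally convex space on a
set `M`: a locally convex model space, a Hausdorff topology on `M` and an atlas all of whose
coordinate changes are smooth. -/
structure Smooth (𝕜 : Type v) [RCLike 𝕜] (M : Type u) where
  Model : Type u
  [acg : AddCommGroup Model]
  [module : Module 𝕜 Model]
  [topModel : TopologicalSpace Model]
  [addGroup : IsTopologicalAddGroup Model]
  [contSMul : ContinuousSMul 𝕜 Model]
  [t2Model : T2Space Model]
  locConvex : @LocallyConvexSpace ℝ Model _ _ _ (Module.compHom Model (algebraMap ℝ 𝕜)) _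
  [top : TopologicalSpace M]
  [t2 : T2Space M]
  [charted : ChartedSpace Model M]
  compat : ∀ e ∈ atlas Model M, ∀ e' ∈ atlas Model M, ∀ n : ℕ,
    IsCn 𝕜 n (fun x => e' (e.symm x)) (e.symm.trans e').source

attribute [instance] Smooth.acg Smooth.module Smooth.topModel Smooth.addGroup Smooth.contSMul
  Smooth.t2Model

namespace Smooth

variable {𝕜 : Type v} [RCLike 𝕜] {M M' P : Type u}

/-- `U` is open in the topology of the manifold structure `A`. -/
def Open (A : Smooth 𝕜 M) (U : Set M) : Prop := IsOpen[A.top] U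

/-- The map `f` is smooth on the open set `U`, with respect to the manifold structures `A` on its
domain and `B` on its codomain. -/
def MapOn (A : Smooth 𝕜 M) (B : Smooth 𝕜 M') (f : M → M') (U : Set M) : Prop :=
  letI := A.top; letI := B.top; letI := A.charted; letI := B.charted
  ContinuousOn f U ∧ ∀ e ∈ atlas A.Model M, ∀ e' ∈ atlas B.Model M', ∀ n : ℕ,
    IsCn 𝕜 n (fun x => e' (f (e.symm x))) (e.target ∩ e.symm ⁻¹' (U ∩ f ⁻¹' e'.source))

/-- Smooth maps between manifolds. -/
def Map (A : Smooth 𝕜 M) (B : Smooth 𝕜 M') (f : M → M') : Prop := A.MapOn B f univ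

/-- Diffeomorphisms. -/
def Diffeo (A : Smooth 𝕜 M) (B : Smooth 𝕜 M') (f : M ≃ M') : Prop :=
  A.Map B f ∧ B.Map A f.symm

/-- The product manifold. -/
def prod (A : Smooth 𝕜 M) (B : Smooth 𝕜 M') : Smooth 𝕜 (M × M') :=
  letI := A.top; letI := B.top; letI := A.charted; letI := B.charted
  letI := A.t2; letI := B.t2
  { Model := A.Model × B.Model
    locConvex := by
      let _ : Module ℝ A.Model := Module.compHom A.Model (algebraMap ℝ 𝕜)
      let _ : Module ℝ B.Model := Module.compHom B.Model (algebraMap ℝ 𝕜)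
      have _ : LocallyConvexSpace ℝ A.Model := A.locConvex
      have _ : LocallyConvexSpace ℝ B.Model := B.locConvex
      exact (inferInstance : LocallyConvexSpace ℝ (A.Model × B.Model))
    charted := prodChartedSpace A.Model M B.Model M'
    compat := by
      rintro _ ⟨e₁, he₁, e₂, he₂, rfl⟩ _ ⟨e₁', he₁', e₂', he₂', rfl⟩ n
      refine ((A.compat e₁ he₁ e₁' he₁' n).prodMap (B.compat e₂ he₂ e₂' he₂' n)).mono ?_
      rintro ⟨x, y⟩ h
      simp only [OpenPartialHomeomorph.trans_source, OpenPartialHomeomorph.symm_source,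
        OpenPartialHomeomorph.prod_target, OpenPartialHomeomorph.prod_source, mem_inter_iff,
        mem_prod, mem_preimage] at h ⊢
      exact ⟨⟨h.1.1, h.2.1⟩, ⟨h.1.2, h.2.2⟩⟩ }

end Smooth

/-! ### Lie groups, split Lie subgroups and extensions -/

section LieGroups

variable {𝕜 : Type v} [RCLike 𝕜]

/-- The manifold structure `A` turns the group `G` into a Lie group. -/
structure IsLieGroup {G : Type u} [Group G] (A : Smooth 𝕜 G) : Prop where
  mul : (A.prod A).Map A (fun p => p.1 * p.2)
  inv : A.Map A (fun x => x⁻¹)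

/-- `π : P → B` is a smooth principal bundle for the right action `(p, h) ↦ p * i h` of the Lie
group `H` on `P` which comes from a morphism of Lie groups `i : H → P`: the map `π` is a smooth
surjection whose fibres are the orbits, and `B` is covered by open sets `U` with a smooth section
`σ : U → P` for which `(b, h) ↦ σ b * i h` is a diffeomorphism `U × H → π ⁻¹ U`
(its inverse being `p ↦ (π p, τ p)`). -/
structure IsPrincipalBundle {H P B : Type u} [Group H] [Group P] (AH : Smooth 𝕜 H)
    (AP : Smooth 𝕜 P) (AB : Smooth 𝕜 B) (i : H →* P) (π : P → B) : Prop where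
  injective : Function.Injective i
  smooth_incl : AH.Map AP i
  smooth_proj : AP.Map AB π
  surjective : Function.Surjective π
  fibre : ∀ x y : P, π x = π y ↔ ∃ h : H, y = x * i h
  locally_trivial : ∀ b : B, ∃ U : Set B, AB.Open U ∧ b ∈ U ∧
    ∃ σ : B → P, AB.MapOn AP σ U ∧ (∀ x ∈ U, π (σ x) = x) ∧
    ∃ τ : P → H, AP.MapOn AH τ (π ⁻¹' U) ∧ ∀ y ∈ π ⁻¹' U, σ (π y) * i (τ y) = y

/-- `H` is a split Lie subgroup of the Lie group `G`, with Lie group structure `AH` on `H` and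
manifold structure `AQ` on the coset space `G ⧸ H`. -/
structure IsSplitLieSubgroup {G : Type u} [Group G] (AG : Smooth 𝕜 G) (H : Subgroup G)
    (AH : Smooth 𝕜 H) (AQ : Smooth 𝕜 (G ⧸ H)) : Prop where
  lie : IsLieGroup AH
  bundle : IsPrincipalBundle AH AG AQ H.subtype (fun x : G => (x : G ⧸ H))

/-- `1 → N → E → G → 1` is an extension of Lie groups: a short exact sequence of morphisms of Lie
groups for which `E` is a smooth `N`-principal bundle over `G`. -/
structure IsLieExtension {N E G : Type u} [Group N] [Group E] [Group G] (AN : Smooth 𝕜 N)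
    (AE : Smooth 𝕜 E) (AG : Smooth 𝕜 G) (ι : N →* E) (q : E →* G) : Prop where
  lie_left : IsLieGroup AN
  lie_mid : IsLieGroup AE
  lie_right : IsLieGroup AG
  exact : ι.range = q.ker
  bundle : IsPrincipalBundle AN AE AG ι q

/-- A Lie group extension of `G` by `N`. -/
structure LieExt {N G : Type u} [Group N] [Group G] (AG : Smooth 𝕜 G) (AN : Smooth 𝕜 N) where
  carrier : Type u
  [group : Group carrier]
  str : Smooth 𝕜 carrier
  ι : N →* carrier
  q : carrier →* G
  isExt : IsLieExtension AN str AG ι q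

attribute [instance] LieExt.group

/-- `φ` is an equivalence of the extensions `N → E₁ → G` and `N → E₂ → G`. -/
structure IsExtEquiv {N E₁ E₂ G : Type u} [Group N] [Group E₁] [Group E₂] [Group G]
    (A₁ : Smooth 𝕜 E₁) (A₂ : Smooth 𝕜 E₂) (ι₁ : N →* E₁) (q₁ : E₁ →* G) (ι₂ : N →* E₂)
    (q₂ : E₂ →* G) (φ : E₁ →* E₂) : Prop where
  smooth : A₁.Map A₂ φ
  comp_left : φ.comp ι₁ = ι₂
  comp_right : q₂.comp φ = q₁

namespace LieExt

variable {N G : Type u} [Group N] [Group G] {AG : Smooth 𝕜 G} {AN : Smooth 𝕜 N}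

/-- Equivalence of Lie group extensions. -/
def Equivalent (E₁ E₂ : LieExt AG AN) : Prop :=
  ∃ φ : E₁.carrier →* E₂.carrier, IsExtEquiv E₁.str E₂.str E₁.ι E₁.q E₂.ι E₂.q φ

theorem ι_injective (E : LieExt AG AN) : Function.Injective E.ι := E.isExt.bundle.injective

/-- The identification of `N` with the normal subgroup `ker q`. -/
noncomputable def kerEquiv (E : LieExt AG AN) : N ≃* E.q.ker :=
  (MonoidHom.ofInjective E.ι_injective).trans (MulEquiv.subgroupCongr E.isExt.exact)

/-- The conjugation representation `C_N` of an extension of `G` by `N` on `N`. -/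
noncomputable def conjN (E : LieExt AG AN) : E.carrier →* MulAut N :=
  (MulAut.congr E.kerEquiv.symm).toMonoidHom.comp MulAut.conjNormal

theorem ι_conjN (E : LieExt AG AN) (x : E.carrier) (n : N) :
    E.ι (E.conjN x n) = x * E.ι n * x⁻¹ := by
  have key : ∀ m : N, ((E.kerEquiv m : E.q.ker) : E.carrier) = E.ι m := fun m => rfl
  have h : E.conjN x n = E.kerEquiv.symm (MulAut.conjNormal x (E.kerEquiv n)) := rfl
  rw [h, ← key, MulEquiv.apply_symm_apply, MulAut.conjNormal_apply, key]

end LieExt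

/-! ### Locally smooth cochains, outer actions, kernels -/

variable {N G : Type u} [Group N] [Group G]

/-- `C^1_s(G,N)`: normalized maps which are smooth on an open identity neighbourhood. -/
def IsC1s (AG : Smooth 𝕜 G) (AN : Smooth 𝕜 N) (f : G → N) : Prop :=
  f 1 = 1 ∧ ∃ U : Set G, AG.Open U ∧ 1 ∈ U ∧ AG.MapOn AN f U

/-- `C^2_{ss}(G,N)`: normalized maps `ω` which are smooth on an open identity neighbourhood and
for which every map `ω_g : x ↦ ω(g, x) ω(g x g⁻¹, g)⁻¹` is smooth on an identity neighbourhood. -/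
structure IsC2ss (AG : Smooth 𝕜 G) (AN : Smooth 𝕜 N) (ω : G → G → N) : Prop where
  one_left : ∀ g, ω 1 g = 1
  one_right : ∀ g, ω g 1 = 1
  locally_smooth : ∃ U : Set (G × G), (AG.prod AG).Open U ∧ (1, 1) ∈ U ∧
    (AG.prod AG).MapOn AN (fun p => ω p.1 p.2) U
  strongly : ∀ g, ∃ U : Set G, AG.Open U ∧ 1 ∈ U ∧
    AG.MapOn AN (fun x => ω g x * (ω (g * x * g⁻¹) g)⁻¹) U

/-- `C^1_s(G, Aut(N))`: maps `S` from `G` to the group of Lie group automorphisms of `N` with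
`S(1) = id` for which `(g, n) ↦ S(g)(n)` is smooth on `U × N` for some open identity
neighbourhood `U`. -/
structure IsC1sAut (AG : Smooth 𝕜 G) (AN : Smooth 𝕜 N) (S : G → MulAut N) : Prop where
  diffeo : ∀ g, AN.Diffeo AN (S g).toEquiv
  one : S 1 = 1
  locally_smooth : ∃ U : Set G, AG.Open U ∧ 1 ∈ U ∧
    (AG.prod AN).MapOn AN (fun p => S p.1 p.2) (U ×ˢ univ)

/-- Strongly smooth outer actions of the Lie group `G` on the Lie group `N`: maps
`S ∈ C^1_s(G, Aut(N))` with `S(g) S(g') S(g g')⁻¹ = C_N(ω(g,g'))` for some `ω ∈ C^2_{ss}(G,N)`. -/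
structure OuterAction (AG : Smooth 𝕜 G) (AN : Smooth 𝕜 N) where
  toFun : G → MulAut N
  isC1sAut : IsC1sAut AG AN toFun
  exists_omega : ∃ ω : G → G → N, IsC2ss AG AN ω ∧
    ∀ g g', toFun g * toFun g' * (toFun (g * g'))⁻¹ = MulAut.conj (ω g g')

instance (AG : Smooth 𝕜 G) (AN : Smooth 𝕜 N) :
    CoeFun (OuterAction AG AN) (fun _ => G → MulAut N) := ⟨OuterAction.toFun⟩

/-- The relation `S ∼ S'`, i.e. `S' = (C_N ∘ h) · S` for some `h ∈ C^1_s(G,N)`. -/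
def SameKernel (AG : Smooth 𝕜 G) (AN : Smooth 𝕜 N) (S S' : G → MulAut N) : Prop :=
  ∃ h : G → N, IsC1s AG AN h ∧ ∀ g, S' g = MulAut.conj (h g) * S g

namespace LieExt

variable {AG : Smooth 𝕜 G} {AN : Smooth 𝕜 N}

/-- The extension `E` of `G` by `N` corresponds to the kernel `[S]`: for a locally smooth
normalized section `σ : G → E` of `q`, the map `C_N ∘ σ` is equivalent to `S`. -/
def CorrespondsTo (E : LieExt AG AN) (S : G → MulAut N) : Prop :=
  ∃ σ : G → E.carrier, IsC1s AG E.str σ ∧ (∀ g, E.q (σ g) = g) ∧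
    SameKernel AG AN S (fun g => E.conjN (σ g))

variable (AG AN) in
/-- The Lie group extensions of `G` by `N` corresponding to `[S]`. -/
def WithKernel (S : G → MulAut N) : Type (max (u + 1) v) :=
  {E : LieExt AG AN // E.CorrespondsTo S}

variable (AG AN) in
/-- `Ext(G,N)_{[S]}`: equivalence classes of Lie group extensions of `G` by `N` corresponding to
`[S]`. -/
def Ext (S : G → MulAut N) : Type (max (u + 1) v) :=
  Quot (fun E₁ E₂ : WithKernel AG AN S => Equivalent E₁.1 E₂.1)

end LieExt

/-! ### The group `G^S` -/

variable (N) in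
/-- The adjoint group `N_ad = N / Z(N)`. -/
abbrev Nad : Type u := N ⧸ Subgroup.center N

theorem ker_conj : (MulAut.conj : N →* MulAut N).ker = Subgroup.center N := by
  ext z
  rw [MonoidHom.mem_ker, Subgroup.mem_center_iff]
  constructor
  · intro h n
    have := DFunLike.congr_fun h n
    simp only [MulAut.conj_apply, MulAut.one_apply] at this
    rw [mul_inv_eq_iff_eq_mul] at this
    exact this.symm
  · intro h
    ext n
    simp only [MulAut.conj_apply, MulAut.one_apply]
    rw [mul_inv_eq_iff_eq_mul, h n]

variable (N) in
/-- The isomorphism `N_ad ≅ C_N(N)`, `n Z(N) ↦ C_N(n)`. -/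
noncomputable def adIso : Nad N ≃* (MulAut.conj : N →* MulAut N).range :=
  (QuotientGroup.quotientMulEquivOfEq ker_conj.symm).trans
    (QuotientGroup.quotientKerEquivRange (MulAut.conj : N →* MulAut N))

variable (N) in
/-- The faithful representation `N_ad → Aut(N)`, `n Z(N) ↦ C_N(n)`. -/
noncomputable def ad : Nad N →* MulAut N :=
  (MulAut.conj : N →* MulAut N).range.subtype.comp (adIso N).toMonoidHom

theorem ad_mk (n : N) : ad N (n : Nad N) = MulAut.conj n := rfl

theorem ad_injective : Function.Injective (ad N) :=
  Subtype.val_injective.comp (adIso N).injective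

theorem ad_mem (a : Nad N) : ad N a ∈ (MulAut.conj : N →* MulAut N).range := (adIso N a).2

theorem ad_adIso_symm (φ : (MulAut.conj : N →* MulAut N).range) :
    ad N ((adIso N).symm φ) = φ := by
  change ((adIso N ((adIso N).symm φ) : (MulAut.conj : N →* MulAut N).range) : MulAut N) = φ
  rw [MulEquiv.apply_symm_apply]

theorem conj_range_normal (φ ψ : MulAut N) (h : ψ ∈ (MulAut.conj : N →* MulAut N).range) :
    φ * ψ * φ⁻¹ ∈ (MulAut.conj : N →* MulAut N).range := by
  obtain ⟨n, rfl⟩ := h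
  refine ⟨φ n, ?_⟩
  ext x
  simp [MulAut.conj_apply]

variable {AG : Smooth 𝕜 G} {AN : Smooth 𝕜 N}

namespace OuterAction

/-- `δ_S(g,g') = S(g) S(g') S(g g')⁻¹`. -/
def delta (S : OuterAction AG AN) (g g' : G) : MulAut N := S g * S g' * (S (g * g'))⁻¹

theorem delta_mem (S : OuterAction AG AN) (g g' : G) :
    S.delta g g' ∈ (MulAut.conj : N →* MulAut N).range := by
  obtain ⟨ω, -, h⟩ := S.exists_omega
  exact ⟨ω g g', (h g g').symm⟩

end OuterAction

/-- The set underlying `G^S`, namely `N_ad × G`. -/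
@[ext]
structure GS (S : OuterAction AG AN) where
  fst : Nad N
  snd : G

namespace GS

variable {S : OuterAction AG AN}

/-- The first component of the product of two elements of `G^S`, in `C_N(N) ≅ N_ad`:
`(C_N(n), g) (C_N(n'), g') = (C_N(n) S(g) C_N(n') S(g)⁻¹ δ_S(g,g'), g g')`. -/
theorem mul_mem (x y : GS S) :
    ad N x.fst * (S x.snd * ad N y.fst * (S x.snd)⁻¹) * S.delta x.snd y.snd ∈
      (MulAut.conj : N →* MulAut N).range :=
  Subgroup.mul_mem _ (Subgroup.mul_mem _ (ad_mem _) (conj_range_normal _ _ (ad_mem _))) (S.delta_mem _ _)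

theorem inv_mem (x : GS S) :
    ((S x.snd)⁻¹ * (ad N x.fst)⁻¹ * (S x.snd)⁻¹⁻¹) * (S.delta x.snd⁻¹ x.snd)⁻¹ ∈
      (MulAut.conj : N →* MulAut N).range :=
  Subgroup.mul_mem _ (conj_range_normal _ _ (Subgroup.inv_mem _ (ad_mem _)))
    (Subgroup.inv_mem _ (S.delta_mem _ _))

noncomputable instance : Mul (GS S) :=
  ⟨fun x y => ⟨(adIso N).symm ⟨_, mul_mem x y⟩, x.snd * y.snd⟩⟩

noncomputable instance : One (GS S) := ⟨⟨1, 1⟩⟩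

noncomputable instance : Inv (GS S) :=
  ⟨fun x => ⟨(adIso N).symm ⟨_, inv_mem x⟩, x.snd⁻¹⟩⟩

theorem ad_mul_fst (x y : GS S) : ad N (x * y).fst =
    ad N x.fst * (S x.snd * ad N y.fst * (S x.snd)⁻¹) * S.delta x.snd y.snd :=
  ad_adIso_symm ⟨_, mul_mem x y⟩

theorem mul_snd (x y : GS S) : (x * y).snd = x.snd * y.snd := rfl

theorem one_fst : (1 : GS S).fst = 1 := rfl

theorem one_snd : (1 : GS S).snd = 1 := rfl

theorem ad_inv_fst (x : GS S) : ad N (x⁻¹).fst =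
    ((S x.snd)⁻¹ * (ad N x.fst)⁻¹ * (S x.snd)⁻¹⁻¹) * (S.delta x.snd⁻¹ x.snd)⁻¹ :=
  ad_adIso_symm ⟨_, inv_mem x⟩

theorem inv_snd (x : GS S) : (x⁻¹).snd = x.snd⁻¹ := rfl

/-- The underlying function of `ρ`. -/
noncomputable def rhoFun (x : GS S) : MulAut N := ad N x.fst * S x.snd

theorem rhoFun_mul (x y : GS S) : rhoFun (x * y) = rhoFun x * rhoFun y := by
  simp only [rhoFun, ad_mul_fst, mul_snd, OuterAction.delta]
  group

theorem rhoFun_one : rhoFun (1 : GS S) = 1 := by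
  simp [rhoFun, one_fst, one_snd, S.isC1sAut.one]

theorem rhoFun_inv_mul (x : GS S) : rhoFun x⁻¹ * rhoFun x = 1 := by
  simp only [rhoFun, ad_inv_fst, inv_snd, OuterAction.delta, inv_mul_cancel, S.isC1sAut.one]
  group

theorem ext_rho {x y : GS S} (h : rhoFun x = rhoFun y) (h' : x.snd = y.snd) : x = y := by
  refine GS.ext (ad_injective ?_) h'
  simpa [rhoFun, h'] using h

noncomputable instance : Group (GS S) :=
  Group.ofLeftAxioms
    (fun x y z => ext_rho (by simp only [rhoFun_mul, mul_assoc])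
      (by simp only [mul_snd, mul_assoc]))
    (fun x => ext_rho (by rw [rhoFun_mul, rhoFun_one, one_mul])
      (by rw [mul_snd, one_snd, one_mul]))
    (fun x => ext_rho (by rw [rhoFun_mul, rhoFun_inv_mul, rhoFun_one])
      (by rw [mul_snd, inv_snd, one_snd, inv_mul_cancel]))

/-- The product of `G^S` in terms of any `ω` with `δ_S = C_N ∘ ω`. -/
theorem mk_mul_mk {ω : G → G → N} (hω : ∀ g g', S.delta g g' = MulAut.conj (ω g g'))
    (n n' : N) (g g' : G) :
    (⟨(n : Nad N), g⟩ * ⟨(n' : Nad N), g'⟩ : GS S) =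
      ⟨((n * S g n' * ω g g' : N) : Nad N), g * g'⟩ := by
  refine GS.ext (ad_injective ?_) rfl
  rw [ad_mul_fst]
  simp only [ad_mk, hω, map_mul]
  congr 2
  ext x
  simp [MulAut.conj_apply]

variable (S)

/-- The action `ρ : G^S → Aut(N)`, `(C_N(n), g) ↦ C_N(n) S(g)`. -/
noncomputable def rho : GS S →* MulAut N where
  toFun := rhoFun
  map_one' := rhoFun_one
  map_mul' := rhoFun_mul

/-- The action of `G^S` on `Z(N)` obtained from `ρ` by restriction. -/
noncomputable def rhoZ : GS S →* MulAut (Subgroup.center N) where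
  toFun x := Subgroup.centerCongr (rho S x)
  map_one' := by
    rw [map_one]
    rfl
  map_mul' x y := by
    rw [map_mul]
    rfl

theorem rhoZ_apply (x : GS S) (z : Subgroup.center N) :
    ((rhoZ S x z : Subgroup.center N) : N) = rho S x (z : N) := rfl

/-- The projection `q_S : G^S → G`. -/
def proj : GS S →* G where
  toFun x := x.snd
  map_one' := rfl
  map_mul' _ _ := rfl

/-- The inclusion `N_ad → G^S`, `C_N(n) ↦ (C_N(n), 1)`. -/
noncomputable def incl : Nad N →* GS S where
  toFun a := ⟨a, 1⟩
  map_one' := rfl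
  map_mul' a b := ext_rho (by rw [rhoFun_mul]; simp [rhoFun, S.isC1sAut.one]) (by simp [mul_snd])

/-- The injection `G^S = C_N(N) × G → Aut(N) × G`. -/
noncomputable def toAutProd (x : GS S) : MulAut N × G := (ad N x.fst, x.snd)

/-- The manifold structure `L` on `G^S` is the natural one: it is a Lie group structure for which,
for some open identity neighbourhood `U` of `G`, the identity map
`N_ad × U → q_S⁻¹(U) ⊆ G^S` is a diffeomorphism onto an open subset. -/
structure IsNatural (Aad : Smooth 𝕜 (Nad N)) (L : Smooth 𝕜 (GS S)) : Prop where
  lie : IsLieGroup L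
  product : ∃ U : Set G, AG.Open U ∧ 1 ∈ U ∧ L.Open (proj S ⁻¹' U) ∧
    (Aad.prod AG).MapOn L (fun p => ⟨p.1, p.2⟩) (univ ×ˢ U) ∧
    L.MapOn (Aad.prod AG) (fun x => (x.fst, x.snd)) (proj S ⁻¹' U)

end GS

namespace LieExt

/-- The map `γ = (C_N · (S ∘ q)⁻¹, q) : E → Aut(N) × G` of an extension `E` of `G` by `N`. -/
noncomputable def gammaMap (S : OuterAction AG AN) (E : LieExt AG AN) (x : E.carrier) :
    MulAut N × G :=
  (E.conjN x * (S (E.q x))⁻¹, E.q x)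

/-- The image of `Z(N)` in an extension of `G` by `N`. -/
def centerImage (E : LieExt AG AN) : Subgroup E.carrier := (Subgroup.center N).map E.ι

instance (E : LieExt AG AN) : E.centerImage.Normal where
  conj_mem := by
    rintro _ ⟨z, hz, rfl⟩ x
    refine ⟨E.conjN x z, ?_, E.ι_conjN x z⟩
    exact (Subgroup.centerCongr (E.conjN x) ⟨z, hz⟩).2

/-- A homomorphism `γ : E → G^S` defines an extension of `G^S` by `Z(N)` with total group `E`. -/
abbrev overGS {S : OuterAction AG AN} {L : Smooth 𝕜 (GS S)} {AZ : Smooth 𝕜 (Subgroup.center N)}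
    (E : LieExt AG AN) (γ : E.carrier →* GS S)
    (h : IsLieExtension AZ E.str L (E.ι.comp (Subgroup.center N).subtype) γ) : LieExt L AZ where
  carrier := E.carrier
  str := E.str
  ι := E.ι.comp (Subgroup.center N).subtype
  q := γ
  isExt := h

variable {S : OuterAction AG AN} {L : Smooth 𝕜 (GS S)} {AZ : Smooth 𝕜 (Subgroup.center N)}

/-- For an extension `γ : F → G^S` by `Z(N)`, the subgroup `γ⁻¹(N_ad)` of `F`. -/
noncomputable def preNad (F : LieExt L AZ) : Subgroup F.carrier := (GS.incl S).range.comap F.q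

/-- The inclusion `Z(N) → γ⁻¹(N_ad)`. -/
noncomputable def preNadι (F : LieExt L AZ) : Subgroup.center N →* F.preNad :=
  F.ι.codRestrict F.preNad (fun z => by
    have h : F.ι z ∈ F.q.ker := F.isExt.exact ▸ ⟨z, rfl⟩
    refine ⟨1, ?_⟩
    rw [map_one, (MonoidHom.mem_ker).1 h])

theorem preNad_snd (F : LieExt L AZ) (x : F.preNad) : (F.q x).snd = 1 := by
  obtain ⟨a, ha⟩ := x.2
  rw [← ha]; rfl

/-- The projection `γ⁻¹(N_ad) → N_ad` obtained from `γ` by restriction. -/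
noncomputable def preNadProj (F : LieExt L AZ) : F.preNad →* Nad N where
  toFun x := (F.q x).fst
  map_one' := by simp [GS.one_fst]
  map_mul' x y := by
    apply ad_injective
    simp [GS.ad_mul_fst, preNad_snd, S.isC1sAut.one, OuterAction.delta]

/-- There is a `G^S`-equivariant equivalence `α : N → γ⁻¹(N_ad) ⊆ F` of central extensions of
`N_ad` by `Z(N)`. Here `γ⁻¹(N_ad)` is considered with its structure of a split Lie subgroup of
`F`, and `γ(x) ∈ G^S` acts on it by conjugation with `x ∈ F`. -/
def HasEquivariantEquiv (AN : Smooth 𝕜 N) {S : OuterAction AG AN} {L : Smooth 𝕜 (GS S)}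
    {AZ : Smooth 𝕜 (Subgroup.center N)} (Aad : Smooth 𝕜 (Nad N)) (F : LieExt L AZ) : Prop :=
  ∃ (P : Smooth 𝕜 F.preNad) (Q : Smooth 𝕜 (F.carrier ⧸ F.preNad)),
    IsSplitLieSubgroup F.str F.preNad P Q ∧
    IsLieExtension AZ P Aad F.preNadι F.preNadProj ∧
    F.preNadι.range ≤ Subgroup.center F.preNad ∧
    ∃ α : N →* F.preNad,
      IsExtEquiv AN P (Subgroup.center N).subtype (QuotientGroup.mk' (Subgroup.center N))
        F.preNadι F.preNadProj α ∧
      ∀ (x : F.carrier) (n : N),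
        (α (GS.rho S (F.q x) n) : F.carrier) = x * (α n : F.carrier) * x⁻¹

end LieExt

end LieGroups

end LCLie

/-!
The difficulty with `G^S` is that `S` is only smooth near `1`: the product manifold structure on
`N_ad × G` makes the multiplication, the inversion and the conjugations of `G^S` smooth near the
identity, but not everywhere. Such local data determine a unique Lie group structure, whose charts
are the left translates of the charts near `1`; it is the natural structure of `G^S`. A homomorphism
of Lie groups is smooth as soon as it is smooth near `1`, so in all that follows only germs at `1`
matter.

An extension `E` of `G` by `N` corresponding to `[S]` has a normalized section `σ`, smooth near `1`,
with `C_N ∘ σ = S`. Then `γ (n σ(g)) = (C_N(n), g)`, which shows at once that `γ` is a smooth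
homomorphism onto `G^S` with kernel `Z(N)`, and that `(C_N(n), g) ↦ s(C_N(n)) σ(g)` is a section of
`γ`, smooth near `1`, for every section `s` of `N → N_ad` of this kind. Together with the initiality
of the inclusion of the kernel this gives the bundle structure, again by translation.

An extension `F` of `G^S` by `Z(N)` comes from an extension of `G` by `N` exactly if the inclusion
of `Z(N)` extends to an equivariant embedding `N → F` over `N_ad`: given such an embedding, `F`
itself, with this copy of `N`, is the extension of `G` that is mapped to `F`.
-/

namespace LCLie

/-! ### Directional derivatives and the chain rule -/

section DirectionalDerivative

variable {𝕜 : Type*} [RCLike 𝕜] {E F : Type*} [AddCommGroup E] [Module 𝕜 E]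
  [AddCommGroup F] [Module 𝕜 F] [TopologicalSpace F]

variable (𝕜) in
/-- `f` has the directional derivative `f'` at `x` in the direction `h`. Mathlib's
`HasLineDerivAt` requires `F` to be normed. -/
def HasDirDerivAt (f : E → F) (f' : F) (x h : E) : Prop :=
  Tendsto (fun t : 𝕜 => t⁻¹ • (f (x + t • h) - f x)) (𝓝[≠] 0) (𝓝 f')

theorem HasDirDerivAt.unique [T2Space F] {f : E → F} {y y' : F} {x h : E}
    (hy : HasDirDerivAt 𝕜 f y x h) (hy' : HasDirDerivAt 𝕜 f y' x h) : y = y' :=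
  tendsto_nhds_unique hy hy'

theorem HasDirDerivAt.comp_line [Module ℝ F] [IsScalarTower ℝ 𝕜 F] {f : E → F} {y : F} {x h : E}
    {t : 𝕜} (ht : t ≠ 0) {s : ℝ} (hf : HasDirDerivAt 𝕜 f y (x + ((s : 𝕜) * t) • h) h) :
    HasDirDerivAt ℝ (fun r : ℝ => t⁻¹ • f (x + ((r : 𝕜) * t) • h)) y s 1 := by
  have hline : Tendsto (fun r : ℝ => (r : 𝕜) * t) (𝓝[≠] 0) (𝓝[≠] 0) := by
    refine tendsto_nhdsWithin_of_tendsto_nhds_of_eventually_within _ ?_ ?_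
    · have hcont : Continuous fun r : ℝ => (r : 𝕜) * t := by fun_prop
      exact (hcont.tendsto' 0 0 (by simp)).mono_left nhdsWithin_le_nhds
    · filter_upwards [self_mem_nhdsWithin] with r hr
      exact mul_ne_zero (RCLike.ofReal_ne_zero.2 hr) ht
  refine (hf.comp hline).congr fun r => ?_
  have hpoint : x + ((s + r • (1 : ℝ) : ℝ) : 𝕜) • t • h =
      x + ((s : 𝕜) * t) • h + ((r : 𝕜) * t) • h := by
    simp only [smul_eq_mul, mul_one, RCLike.ofReal_add, add_smul, mul_smul, add_assoc]
  simp only [Function.comp_apply, mul_smul ((s + r • (1 : ℝ) : ℝ) : 𝕜), hpoint, ← smul_sub]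
  rw [← algebraMap_smul 𝕜 r⁻¹, smul_smul, mul_inv, map_inv₀]

variable [Module ℝ F] [IsTopologicalAddGroup F] [ContinuousSMul ℝ F] [LocallyConvexSpace ℝ F]

/-- By Hahn–Banach the claim reduces to the mean value theorem for real functions. -/
theorem sub_mem_of_hasDirDerivAt_mem {φ φ' : ℝ → F} {C : Set F} (hC : Convex ℝ C)
    (hC' : IsClosed C) (hφ : ∀ s ∈ Icc (0 : ℝ) 1, HasDirDerivAt ℝ φ (φ' s) s 1)
    (hmem : ∀ s ∈ Icc (0 : ℝ) 1, φ' s ∈ C) : φ 1 - φ 0 ∈ C := by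
  by_contra hn
  obtain ⟨l, u, hl, hu⟩ := geometric_hahn_banach_closed_point hC hC' hn
  have hderiv : ∀ s ∈ Icc (0 : ℝ) 1, HasDerivAt (fun r => l (φ r)) (l (φ' s)) s := by
    intro s hs
    rw [hasDerivAt_iff_tendsto_slope_zero]
    simpa [Function.comp_def] using (l.continuous.tendsto _).comp (hφ s hs)
  obtain ⟨s, hs, hslope⟩ := exists_hasDerivAt_eq_slope (fun r => l (φ r)) _ zero_lt_one
    (fun s hs => (hderiv s hs).continuousAt.continuousWithinAt)
    (fun s hs => hderiv s (Ioo_subset_Icc_self hs))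
  have hlt := hl _ (hmem s (Ioo_subset_Icc_self hs))
  rw [hslope, sub_zero, div_one, ← map_sub] at hlt
  exact lt_asymm hlt hu

variable [IsScalarTower ℝ 𝕜 F]

theorem inv_smul_sub_mem_of_hasDirDerivAt_mem {f : E → F} {df : E × E → F} {C : Set F}
    (hC : Convex ℝ C) (hC' : IsClosed C) {x h : E} {t : 𝕜} (ht : t ≠ 0)
    (hd : ∀ s ∈ Icc (0 : ℝ) 1, HasDirDerivAt 𝕜 f (df (x + ((s : 𝕜) * t) • h, h))
      (x + ((s : 𝕜) * t) • h) h)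
    (hmem : ∀ s ∈ Icc (0 : ℝ) 1, df (x + ((s : 𝕜) * t) • h, h) ∈ C) :
    t⁻¹ • (f (x + t • h) - f x) ∈ C := by
  have := sub_mem_of_hasDirDerivAt_mem hC hC' (fun s hs => (hd s hs).comp_line ht) hmem
  simpa [smul_sub] using this

end DirectionalDerivative

section Calculus

variable {𝕜 : Type v} [RCLike 𝕜] {E F : Type u}
  [AddCommGroup E] [Module 𝕜 E] [TopologicalSpace E]
  [AddCommGroup F] [Module 𝕜 F] [TopologicalSpace F]

theorem IsCn.continuousOn {n : ℕ} {f : E → F} {U : Set E} (h : IsCn 𝕜 n f U) :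
    ContinuousOn f U := by
  cases n with
  | zero => exact h
  | succ n => exact h.1

theorem IsCn.of_succ {n : ℕ} : ∀ {E F : Type u}
    [AddCommGroup E] [Module 𝕜 E] [TopologicalSpace E]
    [AddCommGroup F] [Module 𝕜 F] [TopologicalSpace F] {f : E → F} {U : Set E},
    IsCn 𝕜 (n + 1) f U → IsCn 𝕜 n f U := by
  induction n with
  | zero => intro E F _ _ _ _ _ _ f U h; exact h.1
  | succ n ih =>
    intro E F _ _ _ _ _ _ f U h
    obtain ⟨hc, df, hd, hdf⟩ := h
    exact ⟨hc, df, hd, ih hdf⟩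

theorem IsCn.const (n : ℕ) : ∀ {E F : Type u}
    [AddCommGroup E] [Module 𝕜 E] [TopologicalSpace E]
    [AddCommGroup F] [Module 𝕜 F] [TopologicalSpace F] (c : F) (U : Set E),
    IsCn 𝕜 n (fun _ => c) U := by
  induction n with
  | zero => intro E F _ _ _ _ _ _ c U; exact continuousOn_const
  | succ n ih =>
    intro E F _ _ _ _ _ _ c U
    exact ⟨continuousOn_const, fun _ => 0, fun x _ h => by simpa using tendsto_const_nhds, ih 0 _⟩

variable [ContinuousAdd E] [ContinuousSMul 𝕜 E]

theorem eventually_add_smul_mem {U : Set E} {x : E} (hU : U ∈ 𝓝 x) (h : E) :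
    ∀ᶠ t : 𝕜 in 𝓝[≠] 0, x + t • h ∈ U := by
  have hcont : Continuous fun t : 𝕜 => x + t • h := by fun_prop
  exact nhdsWithin_le_nhds (hcont.tendsto' 0 x (by simp) hU)

theorem HasDirDerivAt.congr {f g : E → F} {U : Set E} {x h : E} {y : F}
    (hf : HasDirDerivAt 𝕜 f y x h) (hU : U ∈ 𝓝 x) (hfg : EqOn f g U) :
    HasDirDerivAt 𝕜 g y x h := by
  refine Tendsto.congr' ?_ hf
  filter_upwards [eventually_add_smul_mem hU h] with t ht
  rw [hfg (mem_of_mem_nhds hU), hfg ht]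

theorem eventually_forall_segment_mem {W : Set (E × E)} {x h : E} (hW : W ∈ 𝓝 (x, h))
    {k : 𝕜 → E} (hk : Tendsto k (𝓝[≠] 0) (𝓝 h)) :
    ∀ᶠ t in 𝓝[≠] (0 : 𝕜), ∀ s ∈ Icc (0 : ℝ) 1, (x + ((s : 𝕜) * t) • k t, k t) ∈ W := by
  have hcont : Continuous fun p : 𝕜 × E => (x + p.1 • p.2, p.2) := by fun_prop
  have hprod : ∀ᶠ p in 𝓝 (0 : 𝕜) ×ˢ 𝓝 h, (x + p.1 • p.2, p.2) ∈ W := by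
    rw [← nhds_prod_eq]
    exact hcont.tendsto' (0, h) (x, h) (by simp) hW
  obtain ⟨p, hp, q, hq, hpq⟩ := eventually_prod_iff.1 hprod
  obtain ⟨ε, hε, hball⟩ := Metric.eventually_nhds_iff_ball.1 hp
  filter_upwards [nhdsWithin_le_nhds (Metric.ball_mem_nhds 0 hε), hk.eventually hq]
    with t ht hqt s hs
  refine hpq (hball _ ?_) hqt
  rw [mem_ball_zero_iff] at ht ⊢
  rw [norm_mul, RCLike.norm_ofReal, abs_of_nonneg hs.1]
  exact (mul_le_of_le_one_left (norm_nonneg _) hs.2).trans_lt ht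

/-- The difference quotients lie in the closed convex hull of nearby derivatives. -/
theorem tendsto_inv_smul_sub_of_tendsto_direction [Module ℝ F] [IsScalarTower ℝ 𝕜 F]
    [IsTopologicalAddGroup F] [ContinuousSMul 𝕜 F] [LocallyConvexSpace ℝ F] {f : E → F}
    {df : E × E → F} {U : Set E} (hU : IsOpen U)
    (hd : ∀ x ∈ U, ∀ h, HasDirDerivAt 𝕜 f (df (x, h)) x h) (hdf : ContinuousOn df (U ×ˢ univ))
    {x h : E} (hx : x ∈ U) {k : 𝕜 → E} (hk : Tendsto k (𝓝[≠] 0) (𝓝 h)) :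
    Tendsto (fun t : 𝕜 => t⁻¹ • (f (x + t • k t) - f x)) (𝓝[≠] 0) (𝓝 (df (x, h))) := by
  have : ContinuousSMul ℝ F := IsScalarTower.continuousSMul 𝕜
  refine (LocallyConvexSpace.convex_basis (𝕜 := ℝ) _).nhds_closure.tendsto_right_iff.2 ?_
  rintro C ⟨hCnhds, hC⟩
  have hUnhds : U ×ˢ univ ∈ 𝓝 (x, h) := (hU.prod isOpen_univ).mem_nhds ⟨hx, mem_univ h⟩
  filter_upwards [eventually_forall_segment_mem
    (inter_mem (hdf.continuousAt hUnhds hCnhds) hUnhds) hk, self_mem_nhdsWithin] with t ht ht0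
  exact inv_smul_sub_mem_of_hasDirDerivAt_mem hC.closure isClosed_closure ht0
    (fun s hs => hd _ (ht s hs).2.1 _) fun s hs => subset_closure (ht s hs).1

theorem IsCn.congr {n : ℕ} {f g : E → F} {U : Set E} (hf : IsCn 𝕜 n f U) (hU : IsOpen U)
    (hfg : EqOn f g U) : IsCn 𝕜 n g U := by
  cases n with
  | zero => exact ContinuousOn.congr (f := f) hf hfg.symm
  | succ n =>
    obtain ⟨hc, df, hd, hdf⟩ := hf
    exact ⟨hc.congr hfg.symm, df,
      fun x hx h => HasDirDerivAt.congr (hd x hx h) (hU.mem_nhds hx) hfg, hdf⟩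

theorem IsCn.of_locally {n : ℕ} : ∀ {E F : Type u}
    [AddCommGroup E] [Module 𝕜 E] [TopologicalSpace E]
    [AddCommGroup F] [Module 𝕜 F] [TopologicalSpace F] [ContinuousAdd E] [ContinuousSMul 𝕜 E]
    [T2Space F] {f : E → F} {U : Set E},
    (∀ x ∈ U, ∃ V, IsOpen V ∧ x ∈ V ∧ IsCn 𝕜 n f V) → IsCn 𝕜 n f U := by
  induction n with
  | zero =>
    intro E F _ _ _ _ _ _ _ _ _ f U hloc x hx
    obtain ⟨V, hV, hxV, hf⟩ := hloc x hx
    exact (ContinuousOn.continuousAt hf (hV.mem_nhds hxV)).continuousWithinAt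
  | succ n ih =>
    intro E F _ _ _ _ _ _ _ _ _ f U hloc
    have hexists : ∀ p : E × E, ∃ y : F,
        (∃ y', HasDirDerivAt 𝕜 f y' p.1 p.2) → HasDirDerivAt 𝕜 f y p.1 p.2 := by
      intro p
      by_cases hp : ∃ y', HasDirDerivAt 𝕜 f y' p.1 p.2
      · exact hp.imp fun _ hy _ => hy
      · exact ⟨0, fun hp' => absurd hp' hp⟩
    choose df hdf using hexists
    refine ⟨fun x hx => ?_, df, fun x hx h => ?_, ih ?_⟩
    · obtain ⟨V, hV, hxV, hf⟩ := hloc x hx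
      exact (hf.continuousOn.continuousAt (hV.mem_nhds hxV)).continuousWithinAt
    · obtain ⟨V, -, hxV, -, df', hd', -⟩ := hloc x hx
      exact hdf (x, h) ⟨_, hd' x hxV h⟩
    · rintro ⟨x, h⟩ ⟨hx, -⟩
      obtain ⟨V, hV, hxV, -, df', hd', hdf'⟩ := hloc x hx
      exact ⟨V ×ˢ univ, hV.prod isOpen_univ, ⟨hxV, mem_univ _⟩,
        hdf'.congr (hV.prod isOpen_univ) fun p hp =>
          HasDirDerivAt.unique (hd' p.1 hp.1 p.2) (hdf p ⟨_, hd' p.1 hp.1 p.2⟩)⟩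

theorem IsCn.comp {n : ℕ} {G : Type u} [AddCommGroup G] [Module 𝕜 G] [TopologicalSpace G]
    [IsTopologicalAddGroup G] [ContinuousSMul 𝕜 G] [Module ℝ G] [IsScalarTower ℝ 𝕜 G]
    [LocallyConvexSpace ℝ G] : ∀ {E F : Type u}
    [AddCommGroup E] [Module 𝕜 E] [TopologicalSpace E]
    [AddCommGroup F] [Module 𝕜 F] [TopologicalSpace F] [ContinuousAdd F] [ContinuousSMul 𝕜 F]
    {g : F → G} {f : E → F} {U : Set E} {V : Set F}, IsOpen V →
    IsCn 𝕜 n g V → IsCn 𝕜 n f U → MapsTo f U V → IsCn 𝕜 n (fun x => g (f x)) U := by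
  induction n with
  | zero =>
    intro E F _ _ _ _ _ _ _ _ g f U V _ hg hf hUV
    exact ContinuousOn.comp (g := g) (f := f) hg hf hUV
  | succ n ih =>
    intro E F _ _ _ _ _ _ _ _ g f U V hV hg hf hUV
    have hf' := hf.of_succ
    obtain ⟨hfc, df, hd, hdf⟩ := hf
    obtain ⟨hgc, dg, hd', hdg⟩ := hg
    refine ⟨hgc.comp hfc hUV, fun p => dg (f p.1, df p), fun x hx h => ?_, ?_⟩
    · have := tendsto_inv_smul_sub_of_tendsto_direction hV hd' hdg.continuousOn (hUV hx)
        (hd x hx h)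
      refine this.congr' ?_
      filter_upwards [self_mem_nhdsWithin] with t ht
      rw [smul_smul, mul_inv_cancel₀ (show t ≠ 0 from ht), one_smul, add_sub_cancel]
    · exact ih (hV.prod isOpen_univ) hdg
        (((hf'.comp_clm (ContinuousLinearMap.fst 𝕜 E E)).mono fun _ hp => hp.1).prodMk hdf)
        fun p hp => ⟨hUV hp.1, mem_univ _⟩

end Calculus

/-! ### Germs of smooth maps -/

namespace Smooth

variable {𝕜 : Type v} [RCLike 𝕜] {M M' P : Type u} {A : Smooth 𝕜 M} {B : Smooth 𝕜 M'}
  {C : Smooth 𝕜 P}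

/-- The neighbourhood filter of `x` in the topology of the manifold structure `A`. -/
def nhds (A : Smooth 𝕜 M) (x : M) : Filter M := @_root_.nhds M A.top x

theorem Open.mem_nhds {U : Set M} (hU : A.Open U) {x : M} (hx : x ∈ U) : U ∈ A.nhds x :=
  letI := A.top
  IsOpen.mem_nhds hU hx

theorem mem_nhds_iff {U : Set M} {x : M} : U ∈ A.nhds x ↔ ∃ V ⊆ U, A.Open V ∧ x ∈ V :=
  letI := A.top
  _root_.mem_nhds_iff

theorem nhds_prod (A : Smooth 𝕜 M) (B : Smooth 𝕜 M') (x : M) (y : M') :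
    (A.prod B).nhds (x, y) = A.nhds x ×ˢ B.nhds y :=
  letI := A.top; letI := B.top
  nhds_prod_eq

theorem Open.prod {U : Set M} {V : Set M'} (hU : A.Open U) (hV : B.Open V) :
    (A.prod B).Open (U ×ˢ V) :=
  letI := A.top; letI := B.top
  IsOpen.prod hU hV

theorem open_univ (A : Smooth 𝕜 M) : A.Open univ :=
  letI := A.top
  isOpen_univ

theorem Open.inter {U V : Set M} (hU : A.Open U) (hV : A.Open V) : A.Open (U ∩ V) :=
  letI := A.top
  IsOpen.inter hU hV

theorem open_iff {U : Set M} : A.Open U ↔ ∀ x ∈ U, U ∈ A.nhds x :=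
  letI := A.top
  isOpen_iff_mem_nhds

/-- The map `f` is smooth on an open neighbourhood of `x`. -/
def SmoothAt (A : Smooth 𝕜 M) (B : Smooth 𝕜 M') (f : M → M') (x : M) : Prop :=
  ∃ U : Set M, A.Open U ∧ x ∈ U ∧ A.MapOn B f U

theorem SmoothAt.tendsto {f : M → M'} {x : M} (h : A.SmoothAt B f x) :
    Tendsto f (A.nhds x) (B.nhds (f x)) := by
  let := A.top; let := B.top
  obtain ⟨U, hU, hx, hf⟩ := h
  exact ContinuousOn.continuousAt hf.1 (IsOpen.mem_nhds hU hx)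

theorem isOpen_chartDomain {E F X Y : Type*} [TopologicalSpace E] [TopologicalSpace F]
    [TopologicalSpace X] [TopologicalSpace Y] (e : OpenPartialHomeomorph X E)
    (e' : OpenPartialHomeomorph Y F) {f : X → Y} {U : Set X} (hU : IsOpen U)
    (hf : ContinuousOn f U) : IsOpen (e.target ∩ e.symm ⁻¹' (U ∩ f ⁻¹' e'.source)) :=
  e.isOpen_inter_preimage_symm (hf.isOpen_inter_preimage hU e'.open_source)

theorem MapOn.mono {f : M → M'} {U V : Set M} (hf : A.MapOn B f U) (h : V ⊆ U) :
    A.MapOn B f V :=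
  let _ := A.top; let _ := B.top
  ⟨ContinuousOn.mono hf.1 h, fun e he e' he' n => (hf.2 e he e' he' n).mono
    fun _ hz => ⟨hz.1, h hz.2.1, hz.2.2⟩⟩

theorem mapOn_iff {f : M → M'} {U : Set M} (hU : A.Open U) :
    A.MapOn B f U ↔ ∀ x ∈ U, A.SmoothAt B f x := by
  refine ⟨fun h x hx => ⟨U, hU, hx, h⟩, fun h => ?_⟩
  let := A.top; let := B.top; let := A.charted; let := B.charted
  refine ⟨fun x hx => (show ContinuousAt f x from (h x hx).tendsto).continuousWithinAt,
    fun e he e' he' n => IsCn.of_locally fun z hz => ?_⟩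
  obtain ⟨V, hV, hxV, hf⟩ := h _ hz.2.1
  exact ⟨_, isOpen_chartDomain e e' hV hf.1, ⟨hz.1, hxV, hz.2.2⟩, hf.2 e he e' he' n⟩

theorem map_iff {f : M → M'} : A.Map B f ↔ ∀ x, A.SmoothAt B f x := by
  rw [Smooth.Map, mapOn_iff A.open_univ]
  simp

theorem SmoothAt.congr {f g : M → M'} {x : M} (hf : A.SmoothAt B f x)
    (h : ∀ᶠ y in A.nhds x, f y = g y) : A.SmoothAt B g x := by
  obtain ⟨U, hU, hxU, hf⟩ := hf
  obtain ⟨V, hVs, hV, hxV⟩ := mem_nhds_iff.1 h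
  let := A.top; let := B.top; let := A.charted; let := B.charted
  have hfV := hf.mono (inter_subset_left (t := V))
  have hfg : EqOn f g (U ∩ V) := fun y hy => hVs hy.2
  refine ⟨U ∩ V, hU.inter hV, ⟨hxU, hxV⟩, hfV.1.congr hfg.symm, fun e he e' he' n => ?_⟩
  have hg := (hfV.2 e he e' he' n).congr (isOpen_chartDomain e e' (hU.inter hV) hfV.1)
    (g := fun x => e' (g (e.symm x))) fun z hz => by simp only [hfg hz.2.1]
  refine hg.mono fun z hz => ⟨hz.1, hz.2.1, ?_⟩
  rw [mem_preimage, hfg hz.2.1]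
  exact hz.2.2

theorem SmoothAt.comp {g : M' → P} {f : M → M'} {x : M} (hg : B.SmoothAt C g (f x))
    (hf : A.SmoothAt B f x) : A.SmoothAt C (fun y => g (f y)) x := by
  obtain ⟨U, hU, hxU, hf⟩ := hf
  obtain ⟨V, hV, hxV, hg⟩ := hg
  let := A.top; let := B.top; let := C.top
  let := A.charted; let := B.charted; let := C.charted
  let : Module ℝ C.Model := Module.compHom C.Model (algebraMap ℝ 𝕜)
  have : IsScalarTower ℝ 𝕜 C.Model := .of_algebraMap_smul fun _ _ => rfl
  have : LocallyConvexSpace ℝ C.Model := C.locConvex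
  have hW : IsOpen (U ∩ f ⁻¹' V) := hf.1.isOpen_inter_preimage hU hV
  have hgf : ContinuousOn (fun y => g (f y)) (U ∩ f ⁻¹' V) :=
    hg.1.comp (hf.1.mono inter_subset_left) fun _ hy => hy.2
  refine ⟨U ∩ f ⁻¹' V, hW, ⟨hxU, hxV⟩, hgf, fun e he e' he' n => IsCn.of_locally fun z hz => ?_⟩
  let c := chartAt B.Model (f (e.symm z))
  have hc : c ∈ atlas B.Model M' := chart_mem_atlas _ _
  have hopen := (isOpen_chartDomain e c hU hf.1).inter (isOpen_chartDomain e e' hW hgf)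
  refine ⟨_, hopen, ⟨⟨hz.1, hz.2.1.1, mem_chart_source _ _⟩, hz⟩, ?_⟩
  refine IsCn.congr (IsCn.comp (isOpen_chartDomain c e' hV hg.1) (hg.2 c hc e' he' n)
    ((hf.2 e he c hc n).mono inter_subset_left) fun y hy => ?_) hopen fun y hy => ?_
  · have hy' : f (e.symm y) ∈ c.source := hy.1.2.2
    refine ⟨c.map_source hy', ?_⟩
    rw [mem_preimage, c.left_inv hy']
    exact ⟨hy.2.2.1.2, hy.2.2.2⟩
  · have hy' : f (e.symm y) ∈ c.source := hy.1.2.2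
    simp only [c.left_inv hy']

theorem SmoothAt.comp_of_eq {g : M' → P} {f : M → M'} {x : M} {y : M'} (hg : B.SmoothAt C g y)
    (hf : A.SmoothAt B f x) (hxy : f x = y) : A.SmoothAt C (fun z => g (f z)) x := by
  subst hxy
  exact hg.comp hf

theorem smoothAt_id (A : Smooth 𝕜 M) (x : M) : A.SmoothAt A (fun y => y) x := by
  let := A.top; let := A.charted
  refine ⟨univ, A.open_univ, mem_univ _, continuousOn_id, fun e he e' he' n => ?_⟩
  refine (A.compat e he e' he' n).mono fun z hz => ?_
  rw [OpenPartialHomeomorph.trans_source]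
  exact ⟨hz.1, hz.2.2⟩

theorem smoothAt_const (A : Smooth 𝕜 M) (B : Smooth 𝕜 M') (c : M') (x : M) :
    A.SmoothAt B (fun _ => c) x := by
  let := A.top; let := B.top
  exact ⟨univ, A.open_univ, mem_univ _, continuousOn_const, fun _ _ _ _ n => IsCn.const n _ _⟩

theorem smoothAt_fst (A : Smooth 𝕜 M) (B : Smooth 𝕜 M') (p : M × M') :
    (A.prod B).SmoothAt A (fun q => q.1) p := by
  let := A.top; let := B.top; let := A.charted; let := B.charted
  refine ⟨univ, open_univ _, mem_univ _, continuous_fst.continuousOn, ?_⟩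
  rintro _ ⟨e₁, he₁, e₂, -, rfl⟩ e' he' n
  refine ((A.compat e₁ he₁ e' he' n).comp_clm
    (ContinuousLinearMap.fst 𝕜 A.Model B.Model)).mono fun z hz => ?_
  simp only [OpenPartialHomeomorph.trans_source, mem_preimage]
  exact ⟨hz.1.1, hz.2.2⟩

theorem smoothAt_snd (A : Smooth 𝕜 M) (B : Smooth 𝕜 M') (p : M × M') :
    (A.prod B).SmoothAt B (fun q => q.2) p := by
  let := A.top; let := B.top; let := A.charted; let := B.charted
  refine ⟨univ, open_univ _, mem_univ _, continuous_snd.continuousOn, ?_⟩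
  rintro _ ⟨e₁, -, e₂, he₂, rfl⟩ e' he' n
  refine ((B.compat e₂ he₂ e' he' n).comp_clm
    (ContinuousLinearMap.snd 𝕜 A.Model B.Model)).mono fun z hz => ?_
  simp only [OpenPartialHomeomorph.trans_source, mem_preimage]
  exact ⟨hz.1.2, hz.2.2⟩

theorem SmoothAt.prodMk {f : P → M} {g : P → M'} {x : P} (hf : C.SmoothAt A f x)
    (hg : C.SmoothAt B g x) : C.SmoothAt (A.prod B) (fun y => (f y, g y)) x := by
  obtain ⟨U, hU, hxU, hf⟩ := hf
  obtain ⟨V, hV, hxV, hg⟩ := hg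
  let := A.top; let := B.top; let := A.charted; let := B.charted
  let := C.top; let := C.charted
  have hf := hf.mono (inter_subset_left (t := V))
  have hg := hg.mono (inter_subset_right (s := U))
  refine ⟨U ∩ V, hU.inter hV, ⟨hxU, hxV⟩, hf.1.prodMk hg.1, ?_⟩
  rintro e he _ ⟨e₁, he₁, e₂, he₂, rfl⟩ n
  exact ((hf.2 e he e₁ he₁ n).mono fun z hz => ⟨hz.1, hz.2.1, hz.2.2.1⟩).prodMk
    ((hg.2 e he e₂ he₂ n).mono fun z hz => ⟨hz.1, hz.2.1, hz.2.2.2⟩)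

theorem SmoothAt.fst {f : P → M × M'} {x : P} (hf : C.SmoothAt (A.prod B) f x) :
    C.SmoothAt A (fun y => (f y).1) x :=
  (smoothAt_fst A B _).comp hf

theorem SmoothAt.snd {f : P → M × M'} {x : P} (hf : C.SmoothAt (A.prod B) f x) :
    C.SmoothAt B (fun y => (f y).2) x :=
  (smoothAt_snd A B _).comp hf

theorem Map.smoothAt {f : M → M'} (hf : A.Map B f) (x : M) : A.SmoothAt B f x :=
  map_iff.1 hf x

theorem Map.comp_smoothAt {g : M' → P} {f : M → M'} {x : M} (hg : B.Map C g)
    (hf : A.SmoothAt B f x) : A.SmoothAt C (fun y => g (f y)) x :=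
  (hg.smoothAt _).comp hf

theorem Map.comp {g : M' → P} {f : M → M'} (hg : B.Map C g) (hf : A.Map B f) :
    A.Map C (fun x => g (f x)) :=
  map_iff.2 fun x => hg.comp_smoothAt (hf.smoothAt x)

theorem Open.preimage {f : M → M'} (hf : A.Map B f) {U : Set M'} (hU : B.Open U) :
    A.Open (f ⁻¹' U) :=
  open_iff.2 fun x hx => (hf.smoothAt x).tendsto (hU.mem_nhds hx)

/-- The manifold structure obtained from `A` by transport along a bijection. -/
def congr (A : Smooth 𝕜 M) (φ : M ≃ M') : Smooth 𝕜 M' :=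
  letI := A.top; letI := A.charted
  letI : TopologicalSpace M' := A.top.induced φ.symm
  let ψ : M' ≃ₜ M := φ.symm.toHomeomorphOfIsInducing ⟨rfl⟩
  { Model := A.Model
    locConvex := A.locConvex
    t2 := @Homeomorph.t2Space M M' _ _ A.t2 ψ.symm
    charted :=
      { atlas := (fun e => ψ.transOpenPartialHomeomorph e) '' atlas A.Model M
        chartAt := fun x => ψ.transOpenPartialHomeomorph (chartAt A.Model (ψ x))
        mem_chart_source := fun x => mem_chart_source A.Model (ψ x)
        chart_mem_atlas := fun x => ⟨_, chart_mem_atlas A.Model (ψ x), rfl⟩ }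
    compat := by
      rintro _ ⟨e, he, rfl⟩ _ ⟨e', he', rfl⟩ n
      have h (y : M) : ψ (ψ.symm y) = y := ψ.apply_symm_apply y
      refine ((A.compat e he e' he' n).mono fun x hx => ?_).congr
        (OpenPartialHomeomorph.open_source _) fun x _ => by simp [h]
      simpa [h] using hx }

theorem map_congr (A : Smooth 𝕜 M) (φ : M ≃ M') : A.Map (A.congr φ) φ := by
  let := A.top; let := A.charted
  let : TopologicalSpace M' := A.top.induced φ.symm
  let ψ : M' ≃ₜ M := φ.symm.toHomeomorphOfIsInducing ⟨rfl⟩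
  refine ⟨ψ.symm.continuous.continuousOn, ?_⟩
  rintro e he _ ⟨e', he', rfl⟩ n
  have h (y : M) : ψ (φ y) = y := φ.symm_apply_apply y
  have h' : IsOpen (e.symm.trans e').source := OpenPartialHomeomorph.open_source _
  refine ((A.compat e he e' he' n).congr h' (g := fun x => e' (ψ (φ (e.symm x))))
    fun x _ => by simp [h]).mono fun x hx => ?_
  have hx' : ψ (φ (e.symm x)) ∈ e'.source := hx.2.2
  rw [h] at hx'
  simpa using ⟨hx.1, hx'⟩

theorem map_congr_symm (A : Smooth 𝕜 M) (φ : M ≃ M') : (A.congr φ).Map A φ.symm := by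
  let := A.top; let := A.charted
  let : TopologicalSpace M' := A.top.induced φ.symm
  let ψ : M' ≃ₜ M := φ.symm.toHomeomorphOfIsInducing ⟨rfl⟩
  refine ⟨ψ.continuous.continuousOn, ?_⟩
  rintro _ ⟨e, he, rfl⟩ e' he' n
  have h (y : M) : φ.symm (ψ.symm y) = y := ψ.apply_symm_apply y
  have h' : IsOpen (e.symm.trans e').source := OpenPartialHomeomorph.open_source _
  refine ((A.compat e he e' he' n).congr h'
    (g := fun x => e' (φ.symm (ψ.symm (e.symm x)))) fun x _ => by simp [h]).mono fun x hx => ?_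
  have hx' : φ.symm (ψ.symm (e.symm x)) ∈ e'.source := hx.2.2
  rw [h] at hx'
  simpa using ⟨hx.1, hx'⟩

theorem diffeo_congr (A : Smooth 𝕜 M) (φ : M ≃ M') : A.Diffeo (A.congr φ) φ :=
  ⟨A.map_congr φ, A.map_congr_symm φ⟩

theorem diffeo_refl (A : Smooth 𝕜 M) : A.Diffeo A (Equiv.refl M) :=
  ⟨map_iff.2 A.smoothAt_id, map_iff.2 A.smoothAt_id⟩

theorem Diffeo.symm {e : M ≃ M'} (he : A.Diffeo B e) : B.Diffeo A e.symm :=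
  ⟨he.2, he.1⟩

end Smooth

/-! ### Lie groups, principal bundles and extensions -/

open Smooth (map_iff mapOn_iff)

section Bundles

variable {𝕜 : Type v} [RCLike 𝕜] {M G H N E P B : Type u} [Group G] [Group H] [Group N] [Group E]
  [Group P] {C : Smooth 𝕜 M} {AG : Smooth 𝕜 G} {AH : Smooth 𝕜 H} {AN : Smooth 𝕜 N}
  {AE : Smooth 𝕜 E} {AP : Smooth 𝕜 P} {AB : Smooth 𝕜 B}

namespace IsLieGroup

theorem smoothAt_mul (hG : IsLieGroup AG) {f g : M → G} {x : M} (hf : C.SmoothAt AG f x)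
    (hg : C.SmoothAt AG g x) : C.SmoothAt AG (fun y => f y * g y) x :=
  hG.mul.comp_smoothAt (hf.prodMk hg)

theorem smoothAt_inv (hG : IsLieGroup AG) {f : M → G} {x : M} (hf : C.SmoothAt AG f x) :
    C.SmoothAt AG (fun y => (f y)⁻¹) x :=
  hG.inv.comp_smoothAt hf

theorem smoothAt_const_mul (hG : IsLieGroup AG) (g : G) {f : M → G} {x : M}
    (hf : C.SmoothAt AG f x) : C.SmoothAt AG (fun y => g * f y) x :=
  hG.smoothAt_mul (C.smoothAt_const AG g x) hf

theorem smoothAt_mul_const (hG : IsLieGroup AG) (g : G) {f : M → G} {x : M}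
    (hf : C.SmoothAt AG f x) : C.SmoothAt AG (fun y => f y * g) x :=
  hG.smoothAt_mul hf (C.smoothAt_const AG g x)

theorem map_of_smoothAt_one (hG : IsLieGroup AG) (hH : IsLieGroup AH) {φ : G →* H}
    (h : AG.SmoothAt AH φ 1) : AG.Map AH φ := by
  refine map_iff.2 fun x => ?_
  have hx : AG.SmoothAt AH (fun y => φ x * φ (x⁻¹ * y)) x :=
    hH.smoothAt_const_mul _ (h.comp_of_eq (hG.smoothAt_const_mul x⁻¹ (AG.smoothAt_id x))
      (inv_mul_cancel x))
  simpa only [← map_mul, mul_inv_cancel_left] using hx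

theorem congr (hG : IsLieGroup AG) {e : G ≃* H} (he : AG.Diffeo AH e.toEquiv) :
    IsLieGroup AH where
  mul := map_iff.2 fun p => by
    have h := he.1.comp_smoothAt (hG.smoothAt_mul (he.2.comp_smoothAt (AH.smoothAt_fst AH p))
      (he.2.comp_smoothAt (AH.smoothAt_snd AH p)))
    refine h.congr (Eventually.of_forall fun q => ?_)
    change e (e.symm q.1 * e.symm q.2) = q.1 * q.2
    simp only [map_mul, MulEquiv.apply_symm_apply]
  inv := map_iff.2 fun x => by
    have h := he.1.comp_smoothAt (hG.smoothAt_inv (he.2.smoothAt x))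
    refine h.congr (Eventually.of_forall fun y => ?_)
    change e (e.symm y)⁻¹ = y⁻¹
    simp only [map_inv, MulEquiv.apply_symm_apply]

end IsLieGroup

/-- The map `i : B → M` is initial if a map `f` into `B` is smooth near a point as soon as `i ∘ f`
is. -/
def IsInitial (AB : Smooth 𝕜 B) (C : Smooth 𝕜 M) (i : B → M) : Prop :=
  ∀ ⦃X : Type u⦄ ⦃A : Smooth 𝕜 X⦄ ⦃f : X → B⦄ ⦃x : X⦄,
    A.SmoothAt C (fun y => i (f y)) x → A.SmoothAt AB f x

theorem IsInitial.comp {Y : Type u} {D : Smooth 𝕜 Y} {i : B → M} {j : M → Y}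
    (hj : IsInitial C D j) (hi : IsInitial AB C i) : IsInitial AB D (fun x => j (i x)) :=
  fun _ _ _ _ h => hi (hj h)

theorem IsInitial.of_diffeo {e : B ≃ M} (he : AB.Diffeo C e) : IsInitial AB C e :=
  fun _ _ _ _ h => by simpa only [e.symm_apply_apply] using he.2.comp_smoothAt h

namespace IsPrincipalBundle

variable {i : H →* P} {π : P → B}

theorem proj_mul (h : IsPrincipalBundle AH AP AB i π) (p : P) (k : H) : π (p * i k) = π p :=
  ((h.fibre _ _).2 ⟨k, rfl⟩).symm

theorem exists_section (h : IsPrincipalBundle AH AP AB i π) (b : B) :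
    ∃ σ : B → P, AB.SmoothAt AP σ b ∧ ∀ x, π (σ x) = x := by
  classical
  obtain ⟨U, hU, hbU, σ, hσ, hπσ, -⟩ := h.locally_trivial b
  obtain ⟨s, hs⟩ := h.surjective.hasRightInverse
  refine ⟨U.piecewise σ s, ?_, fun x => ?_⟩
  · refine ((mapOn_iff hU).1 hσ b hbU).congr ?_
    filter_upwards [hU.mem_nhds hbU] with x hx
    rw [U.piecewise_eq_of_mem _ _ hx]
  · by_cases hx : x ∈ U
    · rw [U.piecewise_eq_of_mem _ _ hx, hπσ x hx]
    · rw [U.piecewise_eq_of_notMem _ _ hx, hs x]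

theorem exists_lift (h : IsPrincipalBundle AH AP AB i π) {f : M → B} {x : M}
    (hf : C.SmoothAt AB f x) : ∃ g : M → P, C.SmoothAt AP g x ∧ ∀ y, π (g y) = f y := by
  obtain ⟨σ, hσ, hπσ⟩ := h.exists_section (f x)
  exact ⟨fun y => σ (f y), hσ.comp hf, fun y => hπσ (f y)⟩

theorem exists_smoothAt_eq_mul (h : IsPrincipalBundle AH AP AB i π) (hH : IsLieGroup AH)
    {f g : M → P} {x : M} (hf : C.SmoothAt AP f x) (hg : C.SmoothAt AP g x)
    (hfg : ∀ y, π (f y) = π (g y)) :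
    ∃ k : M → H, C.SmoothAt AH k x ∧ ∀ y, g y = f y * i (k y) := by
  choose k hk using fun y => (h.fibre _ _).1 (hfg y)
  refine ⟨k, ?_, hk⟩
  obtain ⟨U, hU, hxU, σ, -, -, τ, hτ, hστ⟩ := h.locally_trivial (π (f x))
  have hπU := Smooth.Open.preimage h.smooth_proj hU
  have hτ := (mapOn_iff hπU).1 hτ
  refine (hH.smoothAt_mul (hH.smoothAt_inv ((hτ (f x) hxU).comp hf))
    ((hτ (g x) (by rwa [mem_preimage, ← hfg])).comp hg)).congr ?_
  filter_upwards [hf.tendsto (hπU.mem_nhds hxU)] with y (hy : π (f y) ∈ U)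
  rw [inv_mul_eq_iff_eq_mul, hk]
  have hyk : f y * i (k y) ∈ π ⁻¹' U := by rwa [mem_preimage, h.proj_mul]
  refine h.injective (mul_left_cancel (a := σ (π (f y))) ?_)
  rw [map_mul, ← mul_assoc, hστ (f y) hy, ← h.proj_mul (f y) (k y), hστ _ hyk]

theorem isInitial (h : IsPrincipalBundle AH AP AB i π) (hH : IsLieGroup AH) :
    IsInitial AH AP i := by
  intro X A f x hf
  obtain ⟨k, hk, hfk⟩ := h.exists_smoothAt_eq_mul hH (A.smoothAt_const AP 1 x) hf fun y => by
    rw [← h.proj_mul 1 (f y), one_mul]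
  refine hk.congr (Eventually.of_forall fun y => h.injective ?_)
  rw [hfk y, one_mul]

theorem of_exists_section (hP : IsLieGroup AP) (hinj : Function.Injective i) (hi : AH.Map AP i)
    (hin : IsInitial AH AP i) (hπ : AP.Map AB π)
    (hfib : ∀ x y : P, π x = π y ↔ ∃ k : H, y = x * i k)
    (hsec : ∀ b, ∃ σ : B → P, AB.SmoothAt AP σ b ∧ ∀ x, π (σ x) = x) :
    IsPrincipalBundle AH AP AB i π where
  injective := hinj
  smooth_incl := hi
  smooth_proj := hπ
  surjective := fun b => let ⟨σ, _, hσ⟩ := hsec b; ⟨σ b, hσ b⟩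
  fibre := hfib
  locally_trivial := fun b => by
    obtain ⟨σ, ⟨U, hU, hbU, hσ⟩, hπσ⟩ := hsec b
    have hπU : AP.Open (π ⁻¹' U) := Smooth.Open.preimage hπ hU
    choose τ hτ using fun y => (hfib (σ (π y)) y).1 (hπσ _)
    refine ⟨U, hU, hbU, σ, hσ, fun x _ => hπσ x, τ,
      (mapOn_iff hπU).2 fun y hy => hin ?_, fun y _ => (hτ y).symm⟩
    have hσπ := ((mapOn_iff hU).1 hσ _ hy).comp (hπ.smoothAt y)
    refine (hP.smoothAt_mul (hP.smoothAt_inv hσπ) (AP.smoothAt_id y)).congr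
      (Eventually.of_forall fun y => ?_)
    rw [inv_mul_eq_iff_eq_mul, ← hτ]

theorem congr {H' P' B' : Type u} [Group H'] [Group P'] {AH' : Smooth 𝕜 H'} {AP' : Smooth 𝕜 P'}
    {AB' : Smooth 𝕜 B'} {i' : H' →* P'} {π' : P' → B'} (h : IsPrincipalBundle AH AP AB i π)
    {eH : H ≃* H'} {eP : P ≃* P'} {eB : B ≃ B'} (hH : AH.Diffeo AH' eH.toEquiv)
    (hP : AP.Diffeo AP' eP.toEquiv) (hB : AB.Diffeo AB' eB) (hi : ∀ k, i' (eH k) = eP (i k))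
    (hπ : ∀ p, π' (eP p) = eB (π p)) : IsPrincipalBundle AH' AP' AB' i' π' := by
  obtain rfl : i' = eP.toMonoidHom.comp (i.comp eH.symm.toMonoidHom) :=
    MonoidHom.ext fun k => by simpa using hi (eH.symm k)
  obtain rfl : π' = fun p => eB (π (eP.symm p)) := funext fun p => by simpa using hπ (eP.symm p)
  refine
    { injective := eP.injective.comp (h.injective.comp eH.symm.injective)
      smooth_incl := hP.1.comp (h.smooth_incl.comp hH.2)
      smooth_proj := hB.1.comp (h.smooth_proj.comp hP.2)
      surjective := eB.surjective.comp (h.surjective.comp eP.symm.surjective)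
      fibre := fun x y => ?_
      locally_trivial := fun b => ?_ }
  · rw [eB.apply_eq_iff_eq, h.fibre]
    refine eH.toEquiv.exists_congr fun k => ?_
    change eP.symm y = eP.symm x * i k ↔ y = x * eP (i (eH.symm (eH k)))
    rw [eH.symm_apply_apply, eP.symm_apply_eq, map_mul, eP.apply_symm_apply]
  · obtain ⟨U, hU, hbU, σ, hσ, hπσ, τ, hτ, hστ⟩ := h.locally_trivial (eB.symm b)
    have hπU := Smooth.Open.preimage h.smooth_proj hU
    have hV : AB'.Open (eB.symm ⁻¹' U) := Smooth.Open.preimage hB.2 hU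
    have hW : (fun p => eB (π (eP.symm p))) ⁻¹' (eB.symm ⁻¹' U) = eP.symm ⁻¹' (π ⁻¹' U) := by
      ext p
      simp only [mem_preimage, eB.symm_apply_apply]
    refine ⟨_, hV, hbU, fun x => eP (σ (eB.symm x)), (mapOn_iff hV).2 fun x hx =>
      hP.1.comp_smoothAt (((mapOn_iff hU).1 hσ _ hx).comp (hB.2.smoothAt x)), fun x hx => ?_,
      fun p => eH (τ (eP.symm p)), ?_, fun p hp => ?_⟩
    · rw [eP.symm_apply_apply, hπσ _ hx, eB.apply_symm_apply]
    · rw [hW]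
      exact (mapOn_iff (Smooth.Open.preimage hP.2 hπU)).2 fun p hp =>
        hH.1.comp_smoothAt (((mapOn_iff hπU).1 hτ _ hp).comp (hP.2.smoothAt p))
    · rw [hW] at hp
      dsimp only
      rw [eB.symm_apply_apply, hi, ← map_mul, hστ _ hp, eP.apply_symm_apply]

end IsPrincipalBundle

namespace IsLieExtension

variable {ι : N →* E} {q : E →* G}

theorem isInitial (h : IsLieExtension AN AE AG ι q) : IsInitial AN AE ι :=
  h.bundle.isInitial h.lie_left

theorem q_ι (h : IsLieExtension AN AE AG ι q) (n : N) : q (ι n) = 1 :=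
  h.exact.le ⟨n, rfl⟩

theorem of_section (hN : IsLieGroup AN) (hE : IsLieGroup AE) (hG : IsLieGroup AG)
    (hex : ι.range = q.ker) (hinj : Function.Injective ι) (hι : AN.Map AE ι)
    (hin : IsInitial AN AE ι) (hq : AE.Map AG q) {σ : G → E} (hσ : AG.SmoothAt AE σ 1)
    (hqσ : ∀ g, q (σ g) = g) : IsLieExtension AN AE AG ι q where
  lie_left := hN
  lie_mid := hE
  lie_right := hG
  exact := hex
  bundle := by
    refine .of_exists_section hE hinj hι hin hq (fun x y => ?_) fun b =>
      ⟨fun g => σ b * σ (b⁻¹ * g), ?_, fun g => ?_⟩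
    · rw [← inv_mul_eq_one, ← map_inv, ← map_mul, ← MonoidHom.mem_ker, ← hex]
      exact exists_congr fun n => by rw [eq_inv_mul_iff_mul_eq, eq_comm]
    · exact hE.smoothAt_const_mul _ (hσ.comp_of_eq
        (hG.smoothAt_const_mul b⁻¹ (AG.smoothAt_id b)) (inv_mul_cancel b))
    · rw [map_mul, hqσ, hqσ, mul_inv_cancel_left]

theorem exists_section (h : IsLieExtension AN AE AG ι q) :
    ∃ σ : G → E, IsC1s AG AE σ ∧ ∀ g, q (σ g) = g := by
  obtain ⟨σ, hσ, hqσ⟩ := h.bundle.exists_section 1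
  refine ⟨fun g => σ g * (σ 1)⁻¹, ⟨mul_inv_cancel _, h.lie_mid.smoothAt_mul_const _ hσ⟩,
    fun g => ?_⟩
  rw [map_mul, map_inv, hqσ, hqσ, inv_one, mul_one]

theorem congr {E' : Type u} [Group E'] {AE' : Smooth 𝕜 E'} {ι' : N →* E'} {q' : E' →* G}
    (h : IsLieExtension AN AE AG ι q) {e : E ≃* E'} (he : AE.Diffeo AE' e.toEquiv)
    (hι : ∀ n, ι' n = e (ι n)) (hq : ∀ x, q' (e x) = q x) : IsLieExtension AN AE' AG ι' q' where
  lie_left := h.lie_left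
  lie_mid := h.lie_mid.congr he
  lie_right := h.lie_right
  exact := by
    ext y
    obtain ⟨x, rfl⟩ := e.surjective y
    rw [MonoidHom.mem_ker, hq, ← MonoidHom.mem_ker, ← h.exact]
    exact exists_congr fun n => by rw [hι, e.apply_eq_iff_eq]
  bundle := h.bundle.congr (eH := .refl N) (eB := .refl G) AN.diffeo_refl he AG.diffeo_refl hι hq

/-- The identification of `N` with the image `K` of `N` in an extension of `G` by `N`. -/
noncomputable def kernelEquiv (h : IsLieExtension AN AE AG ι q) {K : Subgroup E}
    (hK : ι.range = K) : N ≃* K :=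
  (MonoidHom.ofInjective h.bundle.injective).trans (MulEquiv.subgroupCongr hK)

/-- The isomorphism `E ⧸ K ≃ G` for the image `K` of `N` in an extension of `G` by `N`. -/
noncomputable def quotientEquiv (h : IsLieExtension AN AE AG ι q) {K : Subgroup E} [K.Normal]
    (hK : ι.range = K) : E ⧸ K ≃* G :=
  (QuotientGroup.quotientMulEquivOfEq (hK.symm.trans h.exact)).trans
    (QuotientGroup.quotientKerEquivOfSurjective q h.bundle.surjective)

theorem quotientEquiv_mk (h : IsLieExtension AN AE AG ι q) {K : Subgroup E} [K.Normal]
    (hK : ι.range = K) (x : E) : h.quotientEquiv hK x = q x :=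
  rfl

theorem isSplitLieSubgroup (h : IsLieExtension AN AE AG ι q) {K : Subgroup E} [K.Normal]
    (hK : ι.range = K) :
    IsSplitLieSubgroup AE K (AN.congr (h.kernelEquiv hK).toEquiv)
      (AG.congr (h.quotientEquiv hK).symm.toEquiv) where
  lie := h.lie_left.congr (AN.diffeo_congr _)
  bundle := h.bundle.congr (eP := .refl E) (AN.diffeo_congr _) AE.diffeo_refl (AG.diffeo_congr _)
    (fun _ => rfl) fun x => (h.quotientEquiv hK).eq_symm_apply.2 (h.quotientEquiv_mk hK x)

end IsLieExtension

namespace IsExtEquiv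

variable {E₁ E₂ : Type u} [Group E₁] [Group E₂] {A₁ : Smooth 𝕜 E₁} {A₂ : Smooth 𝕜 E₂}
  {ι₁ : N →* E₁} {q₁ : E₁ →* G} {ι₂ : N →* E₂} {q₂ : E₂ →* G} {φ : E₁ →* E₂}

theorem apply_ι (hφ : IsExtEquiv A₁ A₂ ι₁ q₁ ι₂ q₂ φ) (n : N) : φ (ι₁ n) = ι₂ n :=
  DFunLike.congr_fun hφ.comp_left n

theorem q_apply (hφ : IsExtEquiv A₁ A₂ ι₁ q₁ ι₂ q₂ φ) (x : E₁) : q₂ (φ x) = q₁ x :=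
  DFunLike.congr_fun hφ.comp_right x

theorem injective (hφ : IsExtEquiv A₁ A₂ ι₁ q₁ ι₂ q₂ φ) (h₁ : IsLieExtension AN A₁ AG ι₁ q₁)
    (h₂ : IsLieExtension AN A₂ AG ι₂ q₂) : Function.Injective φ := by
  refine (injective_iff_map_eq_one φ).2 fun x hx => ?_
  have hqx : x ∈ q₁.ker := by rw [MonoidHom.mem_ker, ← hφ.q_apply, hx, map_one]
  obtain ⟨n, rfl⟩ := h₁.exact.ge hqx
  rw [hφ.apply_ι, ← map_one ι₂] at hx
  rw [h₂.bundle.injective hx, map_one]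

theorem exists_smoothAt_rightInverse (hφ : IsExtEquiv A₁ A₂ ι₁ q₁ ι₂ q₂ φ)
    (h₁ : IsLieExtension AN A₁ AG ι₁ q₁) (h₂ : IsLieExtension AN A₂ AG ι₂ q₂) (y : E₂) :
    ∃ ψ : E₂ → E₁, A₂.SmoothAt A₁ ψ y ∧ Function.RightInverse ψ φ := by
  obtain ⟨s, hs, hqs⟩ := h₁.bundle.exists_lift (h₂.bundle.smooth_proj.smoothAt y)
  obtain ⟨n, hn, hsn⟩ := h₂.bundle.exists_smoothAt_eq_mul h₂.lie_left
    (hφ.smooth.comp_smoothAt hs) (A₂.smoothAt_id y) fun z => by rw [hφ.q_apply, hqs]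
  refine ⟨fun z => s z * ι₁ (n z),
    h₁.lie_mid.smoothAt_mul hs (h₁.bundle.smooth_incl.comp_smoothAt hn), fun z => ?_⟩
  rw [map_mul, hφ.apply_ι, ← hsn]

theorem exists_diffeo (hφ : IsExtEquiv A₁ A₂ ι₁ q₁ ι₂ q₂ φ) (h₁ : IsLieExtension AN A₁ AG ι₁ q₁)
    (h₂ : IsLieExtension AN A₂ AG ι₂ q₂) :
    ∃ e : E₁ ≃* E₂, (∀ x, e x = φ x) ∧ A₁.Diffeo A₂ e.toEquiv := by
  have hinv := hφ.exists_smoothAt_rightInverse h₁ h₂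
  have hinj := hφ.injective h₁ h₂
  have hsurj : Function.Surjective φ := fun y =>
    let ⟨ψ, _, hψ⟩ := hinv y
    hψ.surjective y
  let e := MulEquiv.ofBijective φ ⟨hinj, hsurj⟩
  refine ⟨e, fun _ => rfl, hφ.smooth, map_iff.2 fun y => ?_⟩
  obtain ⟨ψ, hψ, hφψ⟩ := hinv y
  exact hψ.congr (Eventually.of_forall fun z => (e.symm_apply_eq.2 (hφψ z).symm).symm)

end IsExtEquiv

end Bundles

/-! ### Lie group structures from local data -/

section LocalData

variable {𝕜 : Type v} [RCLike 𝕜] {K : Type u} [Group K] {A : Smooth 𝕜 K}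

theorem IsLieGroup.of_smoothAt_one (hleft : ∀ k : K, A.Map A (fun x => k * x))
    (hmul : (A.prod A).SmoothAt A (fun p => p.1 * p.2) (1, 1))
    (hinv : A.SmoothAt A (fun x => x⁻¹) 1) (hconj : ∀ k, A.SmoothAt A (MulAut.conj k) 1) :
    IsLieGroup A where
  mul := map_iff.2 fun ⟨a, b⟩ => by
    -- `x y = a b (b⁻¹ (a⁻¹ x) b) (b⁻¹ y)` moves the multiplication near `(a, b)` to `(1, 1)`.
    have hfst := (hconj b⁻¹).comp_of_eq ((hleft a⁻¹).comp_smoothAt (A.smoothAt_fst A (a, b)))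
      (inv_mul_cancel a)
    have hsnd := (hleft b⁻¹).comp_smoothAt (A.smoothAt_snd A (a, b))
    refine ((hleft (a * b)).comp_smoothAt
      (hmul.comp_of_eq (hfst.prodMk hsnd) (by simp))).congr (Eventually.of_forall fun p => ?_)
    simp only [MulAut.conj_apply]
    group
  inv := map_iff.2 fun a => by
    have hinv' := hinv.comp_of_eq ((hleft a⁻¹).smoothAt a) (inv_mul_cancel a)
    refine ((hleft a⁻¹).comp_smoothAt ((hconj a).comp_of_eq hinv' (by simp))).congr
      (Eventually.of_forall fun x => ?_)
    simp only [MulAut.conj_apply]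
    group

theorem smoothAt_conj_mul {k l : K} (hk : A.SmoothAt A (MulAut.conj k) 1)
    (hl : A.SmoothAt A (MulAut.conj l) 1) : A.SmoothAt A (MulAut.conj (k * l)) 1 := by
  rw [map_mul]
  exact hk.comp_of_eq hl (map_one (MulAut.conj l))

theorem exists_open_mul_inv_mem {V : Set K}
    (h : (A.prod A).SmoothAt A (fun p => p.1 * p.2⁻¹) (1, 1)) (hV : A.Open V) (h1V : 1 ∈ V) :
    ∃ O : Set K, A.Open O ∧ 1 ∈ O ∧ ∀ u ∈ O, ∀ w ∈ O, u * w⁻¹ ∈ V := by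
  have hV1 : V ∈ A.nhds ((1 : K) * 1⁻¹) := by
    rw [inv_one, mul_one]
    exact hV.mem_nhds h1V
  have hmem := h.tendsto hV1
  rw [Smooth.nhds_prod, mem_map, mem_prod_self_iff] at hmem
  obtain ⟨W, hW, hWV⟩ := hmem
  obtain ⟨O, hOW, hO, h1O⟩ := Smooth.mem_nhds_iff.1 hW
  exact ⟨O, hO, h1O, fun u hu w hw => hWV (mk_mem_prod (hOW hu) (hOW hw))⟩

end LocalData

namespace Smooth

variable {𝕜 : Type v} [RCLike 𝕜] {M : Type u} {A : Smooth 𝕜 M}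

/-- The local homeomorphisms from a manifold to its model space, for the topology of the manifold
structure `A`. -/
abbrev LocalHomeo (A : Smooth 𝕜 M) : Type _ :=
  @OpenPartialHomeomorph M A.Model A.top _

/-- The atlas of the manifold structure `A`. -/
def charts (A : Smooth 𝕜 M) : Set A.LocalHomeo :=
  letI := A.top; letI := A.charted
  atlas A.Model M

/-- The partial bijection underlying a local homeomorphism. Not mentioning the topology of the
manifold, it can be compared with the charts of a second topology. -/
def partialEquiv (e : A.LocalHomeo) : PartialEquiv M A.Model :=
  letI := A.top
  e.toPartialEquiv

theorem open_inter_preimage (e : A.LocalHomeo) {O : Set A.Model} (hO : IsOpen O) :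
    A.Open ((partialEquiv e).source ∩ partialEquiv e ⁻¹' O) :=
  let _ := A.top
  e.isOpen_inter_preimage hO

theorem isOpen_inter_preimage_symm (e : A.LocalHomeo) {O : Set M} (hO : A.Open O) :
    IsOpen ((partialEquiv e).target ∩ (partialEquiv e).symm ⁻¹' O) :=
  let _ := A.top
  e.isOpen_inter_preimage_symm hO

end Smooth

/-- A manifold structure `A` on a group `K` which is compatible with the multiplication near the
identity: left translations between points of the open identity neighbourhood `V` are smooth, and
multiplication, inversion and all conjugations are smooth at the identity. -/
structure LocalLieGroup {𝕜 : Type v} [RCLike 𝕜] {K : Type u} [Group K] (A : Smooth 𝕜 K)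
    (V : Set K) : Prop where
  isOpen : A.Open V
  one_mem : 1 ∈ V
  left : ∀ k, ∀ x ∈ V, k * x ∈ V → A.SmoothAt A (fun y => k * y) x
  mul : (A.prod A).SmoothAt A (fun p => p.1 * p.2) (1, 1)
  inv : A.SmoothAt A (fun x => x⁻¹) 1
  conj : ∀ k, A.SmoothAt A (MulAut.conj k) 1

namespace LocalLieGroup

open Smooth (LocalHomeo charts partialEquiv)

variable {𝕜 : Type v} [RCLike 𝕜] {K : Type u} [Group K] {A : Smooth 𝕜 K} {V : Set K}

/-- The left invariant topology which agrees with the given one on `V`. -/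
abbrev topology (h : LocalLieGroup A V) : TopologicalSpace K :=
  letI := A.top
  { IsOpen := fun s => ∀ k, A.Open (V ∩ (fun x => k * x) ⁻¹' s)
    isOpen_univ := fun k => by simpa only [preimage_univ, inter_univ] using h.isOpen
    isOpen_inter := fun s t hs ht k => by
      rw [preimage_inter, inter_inter_distrib_left]
      exact (hs k).inter (ht k)
    isOpen_sUnion := fun S hS k => by
      rw [preimage_sUnion, inter_iUnion₂]
      exact isOpen_biUnion fun s hs => hS s hs k }

variable (h : LocalLieGroup A V)

theorem isOpen_of_subset {s : Set K} (hs : A.Open s) (hsV : s ⊆ V) : IsOpen[h.topology] s :=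
  fun k => Smooth.open_iff.2 fun x hx => inter_mem (h.isOpen.mem_nhds hx.1)
    ((h.left k x hx.1 (hsV hx.2)).tendsto (hs.mem_nhds hx.2))

theorem open_inter {s : Set K} (hs : IsOpen[h.topology] s) : A.Open (V ∩ s) := by
  simpa only [one_mul, preimage_id'] using hs 1

theorem isOpen_preimage_mul_left {s : Set K} (hs : IsOpen[h.topology] s) (k : K) :
    IsOpen[h.topology] ((fun x => k * x) ⁻¹' s) := by
  intro k'
  simpa only [preimage_preimage, mul_assoc] using hs (k * k')

/-- Left translation by `k`, as a homeomorphism of the left invariant topology. -/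
def translation (k : K) : @Homeomorph K K h.topology h.topology :=
  letI := h.topology
  { Equiv.mulLeft k with
    continuous_toFun := ⟨fun _ hs => h.isOpen_preimage_mul_left hs k⟩
    continuous_invFun := ⟨fun _ hs => h.isOpen_preimage_mul_left hs k⁻¹⟩ }

theorem exists_separated_of_mem {k : K} (hkV : k ∈ V) (hk : k ≠ 1) :
    ∃ O O' : Set K, IsOpen[h.topology] O ∧ IsOpen[h.topology] O' ∧ 1 ∈ O ∧ 1 ∈ O' ∧
      ∀ u ∈ O, ∀ w ∈ O', u ≠ k * w := by
  let := A.top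
  have := A.t2
  obtain ⟨O, O', hO, hO', h1O, hkO', hd⟩ := t2_separation hk.symm
  refine ⟨V ∩ O, (fun x => k * x) ⁻¹' (V ∩ O'),
    h.isOpen_of_subset (h.isOpen.inter hO) inter_subset_left,
    h.isOpen_preimage_mul_left (h.isOpen_of_subset (h.isOpen.inter hO') inter_subset_left) k,
    ⟨h.one_mem, h1O⟩, by rwa [mem_preimage, mul_one, mem_inter_iff, and_iff_right hkV], ?_⟩
  rintro u hu w hw rfl
  exact disjoint_left.1 hd hu.2 hw.2

theorem exists_separated_of_notMem {k : K} (hkV : k ∉ V) :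
    ∃ O O' : Set K, IsOpen[h.topology] O ∧ IsOpen[h.topology] O' ∧ 1 ∈ O ∧ 1 ∈ O' ∧
      ∀ u ∈ O, ∀ w ∈ O', u ≠ k * w := by
  have hinv : (A.prod A).SmoothAt A (fun p => p.2⁻¹) (1, 1) :=
    h.inv.comp_of_eq (A.smoothAt_snd A (1, 1)) rfl
  have hdiv : (A.prod A).SmoothAt A (fun p => p.1 * p.2⁻¹) (1, 1) :=
    h.mul.comp_of_eq ((A.smoothAt_fst A (1, 1)).prodMk hinv) (by rw [inv_one])
  obtain ⟨O, hO, h1O, hOV⟩ := exists_open_mul_inv_mem hdiv h.isOpen h.one_mem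
  have hVO := h.isOpen_of_subset (h.isOpen.inter hO) inter_subset_left
  refine ⟨V ∩ O, V ∩ O, hVO, hVO, ⟨h.one_mem, h1O⟩, ⟨h.one_mem, h1O⟩, ?_⟩
  rintro u hu w hw rfl
  have hk := hOV _ hu.2 _ hw.2
  rw [mul_inv_cancel_right] at hk
  exact hkV hk

theorem t2Space (h : LocalLieGroup A V) : @T2Space K h.topology := by
  let := h.topology
  refine ⟨fun x y hxy => ?_⟩
  have hk : x⁻¹ * y ≠ 1 := by rwa [Ne, inv_mul_eq_one]
  obtain ⟨O, O', hO, hO', h1, h1', hd⟩ := (em (x⁻¹ * y ∈ V)).elim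
    (fun hkV => h.exists_separated_of_mem hkV hk) h.exists_separated_of_notMem
  refine ⟨_, _, h.isOpen_preimage_mul_left hO x⁻¹, h.isOpen_preimage_mul_left hO' y⁻¹, ?_, ?_,
    disjoint_left.2 fun z hz hz' => hd _ hz _ hz' ?_⟩
  · rwa [mem_preimage, inv_mul_cancel]
  · rwa [mem_preimage, inv_mul_cancel]
  · rw [mul_assoc, mul_inv_cancel_left]

theorem isOpen_inter_preimage_restr (e : A.LocalHomeo) {O : Set A.Model} (hO : IsOpen O) :
    IsOpen[h.topology]
      (((partialEquiv e).restr V).source ∩ (partialEquiv e).restr V ⁻¹' O) := by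
  have hVO : ((partialEquiv e).restr V).source ∩ (partialEquiv e).restr V ⁻¹' O =
      ((partialEquiv e).source ∩ partialEquiv e ⁻¹' O) ∩ V := inter_right_comm _ _ _
  rw [hVO]
  exact h.isOpen_of_subset ((Smooth.open_inter_preimage e hO).inter h.isOpen) inter_subset_right

theorem isOpen_inter_preimage_restr_symm (e : A.LocalHomeo) {O : Set K}
    (hO : IsOpen[h.topology] O) :
    IsOpen (((partialEquiv e).restr V).target ∩ ((partialEquiv e).restr V).symm ⁻¹' O) := by
  have hVO : ((partialEquiv e).restr V).target ∩ ((partialEquiv e).restr V).symm ⁻¹' O =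
      (partialEquiv e).target ∩ (partialEquiv e).symm ⁻¹' (V ∩ O) := inter_assoc _ _ _
  rw [hVO]
  exact Smooth.isOpen_inter_preimage_symm e (h.open_inter hO)

/-- The restriction of a chart to `V`, as a chart for the left invariant topology. -/
def baseChart (e : A.LocalHomeo) : @OpenPartialHomeomorph K A.Model h.topology _ :=
  letI := h.topology
  have hs : IsOpen ((partialEquiv e).restr V).source := by
    simpa only [preimage_univ, inter_univ] using h.isOpen_inter_preimage_restr e isOpen_univ
  have ht : IsOpen ((partialEquiv e).restr V).target := by
    simpa only [preimage_univ, inter_univ] using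
      h.isOpen_inter_preimage_restr_symm e (@isOpen_univ K h.topology)
  { toPartialEquiv := (partialEquiv e).restr V
    open_source := hs
    open_target := ht
    continuousOn_toFun :=
      (continuousOn_open_iff hs).2 fun _ hO => h.isOpen_inter_preimage_restr e hO
    continuousOn_invFun :=
      (continuousOn_open_iff ht).2 fun _ hO => h.isOpen_inter_preimage_restr_symm e hO }

/-- The translate by `k` of the restriction of a chart to `V`. -/
def chart (k : K) (e : A.LocalHomeo) : @OpenPartialHomeomorph K A.Model h.topology _ :=
  letI := h.topology
  (h.translation k⁻¹).transOpenPartialHomeomorph (h.baseChart e)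

theorem isCn_mul_left (h : LocalLieGroup A V) (k : K) {e e' : A.LocalHomeo} (he : e ∈ A.charts)
    (he' : e' ∈ A.charts) (n : ℕ) :
    IsCn 𝕜 n (fun x => partialEquiv e' (k * (partialEquiv e).symm x))
      {x | x ∈ (partialEquiv e).target ∧ (partialEquiv e).symm x ∈ V ∧
        k * (partialEquiv e).symm x ∈ V ∧
        k * (partialEquiv e).symm x ∈ (partialEquiv e').source} := by
  let := A.top
  let := A.charted
  have hk : A.MapOn A (fun y => k * y) (V ∩ (fun x => k * x) ⁻¹' V) :=
    (mapOn_iff (h.isOpen_of_subset h.isOpen subset_rfl k)).2 fun x hx => h.left k x hx.1 hx.2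
  exact (hk.2 e he e' he' n).mono fun _ hx => ⟨hx.1, ⟨hx.2.1, hx.2.2.1⟩, hx.2.2.2⟩

/-- The left invariant manifold structure which agrees with the given one on `V`. -/
def leftInvariant (h : LocalLieGroup A V) : Smooth 𝕜 K where
  Model := A.Model
  locConvex := A.locConvex
  top := h.topology
  t2 := h.t2Space
  charted :=
    letI := h.topology
    { atlas := {c | ∃ k, ∃ e ∈ A.charts, c = h.chart k e}
      chartAt := fun x => h.chart x (letI := A.top; letI := A.charted; chartAt A.Model 1)
      mem_chart_source := fun x => by
        let := A.top
        let := A.charted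
        change x⁻¹ * x ∈ (chartAt A.Model (1 : K)).source ∩ V
        rw [inv_mul_cancel]
        exact ⟨mem_chart_source A.Model (1 : K), h.one_mem⟩
      chart_mem_atlas := fun x =>
        letI := A.top
        letI := A.charted
        ⟨x, _, chart_mem_atlas A.Model (1 : K), rfl⟩ }
  compat := by
    rintro _ ⟨k, e, he, rfl⟩ _ ⟨k', e', he', rfl⟩ n
    have hcn := h.isCn_mul_left (k'⁻¹ * k⁻¹⁻¹) he he' n
    simp only [mul_assoc] at hcn
    exact hcn.mono fun x hx => ⟨hx.1.1, hx.1.2, hx.2.2, hx.2.1⟩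

theorem map_leftInvariant_mul_left (k : K) :
    h.leftInvariant.Map h.leftInvariant (fun x => k * x) := by
  let := h.topology
  refine ⟨(h.translation k).continuous.continuousOn, ?_⟩
  rintro _ ⟨k₁, e, he, rfl⟩ _ ⟨k', e', he', rfl⟩ n
  have hcn := h.isCn_mul_left (k'⁻¹ * (k * k₁⁻¹⁻¹)) he he' n
  simp only [mul_assoc] at hcn
  exact hcn.mono fun x hx => ⟨hx.1.1, hx.1.2, hx.2.2.2, hx.2.2.1⟩

theorem smoothAt_id_leftInvariant {x : K} (hx : x ∈ V) :
    A.SmoothAt h.leftInvariant (fun y => y) x := by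
  refine ⟨V, h.isOpen, hx, (@continuousOn_open_iff _ _ A.top h.topology _ _ h.isOpen).2
    fun s hs => h.open_inter hs, ?_⟩
  rintro e he _ ⟨k', e', he', rfl⟩ n
  exact (h.isCn_mul_left k'⁻¹ he he' n).mono fun x hx => ⟨hx.1, hx.2.1, hx.2.2.2, hx.2.2.1⟩

theorem leftInvariant_smoothAt_id {x : K} (hx : x ∈ V) :
    h.leftInvariant.SmoothAt A (fun y => y) x := by
  have hV : h.leftInvariant.Open V := h.isOpen_of_subset h.isOpen subset_rfl
  refine ⟨V, hV, hx, (@continuousOn_open_iff _ _ h.topology A.top _ _ hV).2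
    fun s hs => h.isOpen_of_subset (h.isOpen.inter hs) inter_subset_left, ?_⟩
  rintro _ ⟨k, e, he, rfl⟩ e' he' n
  exact (h.isCn_mul_left k⁻¹⁻¹ he he' n).mono fun x hx => ⟨hx.1.1, hx.1.2, hx.2.1, hx.2.2⟩

theorem leftInvariant_smoothAt {f : K → K} (hf : A.SmoothAt A f 1) (hf1 : f 1 = 1) :
    h.leftInvariant.SmoothAt h.leftInvariant f 1 := by
  have hfA : h.leftInvariant.SmoothAt A f 1 :=
    hf.comp_of_eq (h.leftInvariant_smoothAt_id h.one_mem) rfl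
  exact (h.smoothAt_id_leftInvariant h.one_mem).comp_of_eq hfA hf1

theorem isLieGroup (h : LocalLieGroup A V) : IsLieGroup h.leftInvariant := by
  refine .of_smoothAt_one h.map_leftInvariant_mul_left ?_ (h.leftInvariant_smoothAt h.inv inv_one)
    fun k => h.leftInvariant_smoothAt (h.conj k) (map_one (MulAut.conj k))
  have hid := h.leftInvariant_smoothAt_id h.one_mem
  have hfst : (h.leftInvariant.prod h.leftInvariant).SmoothAt A Prod.fst (1, 1) :=
    hid.comp_of_eq (h.leftInvariant.smoothAt_fst h.leftInvariant (1, 1)) rfl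
  have hsnd : (h.leftInvariant.prod h.leftInvariant).SmoothAt A Prod.snd (1, 1) :=
    hid.comp_of_eq (h.leftInvariant.smoothAt_snd h.leftInvariant (1, 1)) rfl
  have hmul : (h.leftInvariant.prod h.leftInvariant).SmoothAt A (fun p => p.1 * p.2) (1, 1) :=
    h.mul.comp_of_eq (hfst.prodMk hsnd) rfl
  exact (h.smoothAt_id_leftInvariant h.one_mem).comp_of_eq hmul (one_mul 1)

end LocalLieGroup

/-! ### The natural Lie group structure on `G^S` -/

section Natural

variable {𝕜 : Type v} [RCLike 𝕜] {M G N P : Type u} [Group G] [Group N] [Group P]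
  {C : Smooth 𝕜 M} {AG : Smooth 𝕜 G} {AN : Smooth 𝕜 N} {AP : Smooth 𝕜 P}
  {AZ : Smooth 𝕜 (Subgroup.center N)} {Aad : Smooth 𝕜 (Nad N)}

namespace IsSplitLieSubgroup

variable {K : Subgroup P} [K.Normal] {AK : Smooth 𝕜 K} {AQ : Smooth 𝕜 (P ⧸ K)}

theorem isLieGroup_quotient (h : IsSplitLieSubgroup AP K AK AQ) (hP : IsLieGroup AP) :
    IsLieGroup AQ where
  mul := map_iff.2 fun p => by
    obtain ⟨σ, hσ, hmkσ⟩ := h.bundle.exists_lift (AQ.smoothAt_fst AQ p)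
    obtain ⟨τ, hτ, hmkτ⟩ := h.bundle.exists_lift (AQ.smoothAt_snd AQ p)
    refine (h.bundle.smooth_proj.comp_smoothAt (hP.smoothAt_mul hσ hτ)).congr
      (Eventually.of_forall fun y => ?_)
    rw [QuotientGroup.mk_mul, hmkσ, hmkτ]
  inv := map_iff.2 fun a => by
    obtain ⟨σ, hσ, hmkσ⟩ := h.bundle.exists_section a
    refine (h.bundle.smooth_proj.comp_smoothAt (hP.smoothAt_inv hσ)).congr
      (Eventually.of_forall fun y => ?_)
    rw [QuotientGroup.mk_inv, hmkσ]

theorem isLieExtension (h : IsSplitLieSubgroup AP K AK AQ) (hP : IsLieGroup AP) :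
    IsLieExtension AK AP AQ K.subtype (QuotientGroup.mk' K) where
  lie_left := h.lie
  lie_mid := hP
  lie_right := h.isLieGroup_quotient hP
  exact := by rw [K.range_subtype, QuotientGroup.ker_mk']
  bundle := h.bundle

end IsSplitLieSubgroup

theorem IsC1sAut.smoothAt_apply {S : G → MulAut N} (hS : IsC1sAut AG AN S) {f : M → G}
    {k : M → N} {x : M} (hf : C.SmoothAt AG f x) (hfx : f x = 1) (hk : C.SmoothAt AN k x) :
    C.SmoothAt AN (fun y => S (f y) (k y)) x := by
  obtain ⟨U, hU, h1U, hSU⟩ := hS.locally_smooth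
  exact ((mapOn_iff (hU.prod AN.open_univ)).1 hSU (1, k x) ⟨h1U, mem_univ _⟩).comp_of_eq
    (hf.prodMk hk) (by rw [hfx])

theorem IsC2ss.exists_open_smoothAt {ω : G → G → N} (hω : IsC2ss AG AN ω) :
    ∃ W : Set G, AG.Open W ∧ 1 ∈ W ∧
      ∀ g ∈ W, ∀ g' ∈ W, (AG.prod AG).SmoothAt AN (fun p => ω p.1 p.2) (g, g') := by
  obtain ⟨O, hO, h1O, hωO⟩ := hω.locally_smooth
  have hmem := hO.mem_nhds h1O
  rw [Smooth.nhds_prod, mem_prod_self_iff] at hmem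
  obtain ⟨W', hW', hWO⟩ := hmem
  obtain ⟨W, hWW', hW, h1W⟩ := Smooth.mem_nhds_iff.1 hW'
  exact ⟨W, hW, h1W, fun g hg g' hg' =>
    (mapOn_iff hO).1 hωO _ (hWO (mk_mem_prod (hWW' hg) (hWW' hg')))⟩

namespace GS

variable (S : OuterAction AG AN)

/-- The bijection `N_ad × G → G^S`. -/
def prodEquiv : Nad N × G ≃ GS S where
  toFun p := ⟨p.1, p.2⟩
  invFun x := (x.fst, x.snd)

/-- The product manifold structure on `G^S = N_ad × G`. It agrees with the natural one only near
the fibre `N_ad`. -/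
def prodSmooth (Aad : Smooth 𝕜 (Nad N)) : Smooth 𝕜 (GS S) := (Aad.prod AG).congr (prodEquiv S)

variable {S}

theorem smoothAt_prodSmooth {f : M → GS S} {x : M} : C.SmoothAt (prodSmooth S Aad) f x ↔
    C.SmoothAt Aad (fun y => (f y).fst) x ∧ C.SmoothAt AG (fun y => (f y).snd) x := by
  refine ⟨fun hf => ?_, fun hf => ?_⟩
  · have hf' := ((Aad.prod AG).map_congr_symm (prodEquiv S)).comp_smoothAt hf
    exact ⟨hf'.fst, hf'.snd⟩
  · exact ((Aad.prod AG).map_congr (prodEquiv S)).comp_smoothAt (hf.1.prodMk hf.2)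

variable {ω : G → G → N}

section Coordinates

variable (hω : ∀ g g', S.delta g g' = MulAut.conj (ω g g'))
include hω

theorem mul_fst (x y : GS S) {n n' : N} (hn : (n : Nad N) = x.fst) (hn' : (n' : Nad N) = y.fst) :
    (x * y).fst = ((n * S x.snd n' * ω x.snd y.snd : N) : Nad N) := by
  obtain ⟨_, g⟩ := x
  obtain ⟨_, g'⟩ := y
  subst hn hn'
  rw [mk_mul_mk hω]

theorem inv_fst (x : GS S) {n : N} (hn : (n : Nad N) = x.fst) :
    x⁻¹.fst = (((S x.snd⁻¹ n * ω x.snd⁻¹ x.snd)⁻¹ : N) : Nad N) := by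
  suffices hx : (⟨((S x.snd⁻¹ n * ω x.snd⁻¹ x.snd)⁻¹ : N), x.snd⁻¹⟩ : GS S) * x = 1 by
    rw [← eq_inv_of_mul_eq_one_left hx]
  refine GS.ext ?_ (inv_mul_cancel _)
  rw [mul_fst hω _ x rfl hn, mul_assoc, inv_mul_cancel, QuotientGroup.mk_one, one_fst]

theorem conj_fst (g : G) (x : GS S) {n : N} (hn : (n : Nad N) = x.fst) :
    (MulAut.conj (⟨1, g⟩ : GS S) x).fst =
      ((S g n * (ω g x.snd * (ω (g * x.snd * g⁻¹) g)⁻¹) : N) : Nad N) := by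
  suffices hx : MulAut.conj (⟨1, g⟩ : GS S) x =
      ⟨(S g n * (ω g x.snd * (ω (g * x.snd * g⁻¹) g)⁻¹) : N), g * x.snd * g⁻¹⟩ by rw [hx]
  rw [MulAut.conj_apply, mul_inv_eq_iff_eq_mul]
  refine GS.ext ?_ (by simp only [mul_snd, inv_mul_cancel_right])
  rw [mul_fst hω ⟨1, g⟩ x (QuotientGroup.mk_one _) hn,
    mul_fst hω _ ⟨1, g⟩ rfl (QuotientGroup.mk_one _)]
  simp only [one_mul, map_one, mul_one, mul_assoc, inv_mul_cancel]

variable (hG : IsLieGroup AG) (hN : IsLieGroup AN)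
  (hZ : IsSplitLieSubgroup AN (Subgroup.center N) AZ Aad)
include hG hN hZ

theorem smoothAt_mul {f g : M → GS S} {x : M}
    (hf : C.SmoothAt (prodSmooth S Aad) f x) (hg : C.SmoothAt (prodSmooth S Aad) g x)
    (hS : ∀ ν : M → N, C.SmoothAt AN ν x → C.SmoothAt AN (fun y => S (f y).snd (ν y)) x)
    (hωfg : C.SmoothAt AN (fun y => ω (f y).snd (g y).snd) x) :
    C.SmoothAt (prodSmooth S Aad) (fun y => f y * g y) x := by
  rw [smoothAt_prodSmooth] at hf hg ⊢
  refine ⟨?_, hG.smoothAt_mul hf.2 hg.2⟩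
  obtain ⟨m, hm, hmf⟩ := hZ.bundle.exists_lift hf.1
  obtain ⟨n, hn, hng⟩ := hZ.bundle.exists_lift hg.1
  exact (hZ.bundle.smooth_proj.comp_smoothAt
    (hN.smoothAt_mul (hN.smoothAt_mul hm (hS n hn)) hωfg)).congr
    (Eventually.of_forall fun y => (mul_fst hω (f y) (g y) (hmf y) (hng y)).symm)

theorem smoothAt_inv (hωs : (AG.prod AG).SmoothAt AN (fun p => ω p.1 p.2) (1, 1)) :
    (prodSmooth S Aad).SmoothAt (prodSmooth S Aad) (fun x => x⁻¹) 1 := by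
  obtain ⟨hfst, hsnd⟩ := smoothAt_prodSmooth.1 ((prodSmooth S Aad).smoothAt_id 1)
  obtain ⟨n, hn, hmkn⟩ := hZ.bundle.exists_lift hfst
  have hinv := hG.smoothAt_inv hsnd
  refine smoothAt_prodSmooth.2 ⟨?_, hinv⟩
  have hSn := S.isC1sAut.smoothAt_apply hinv inv_one hn
  have hωinv := hωs.comp_of_eq (hinv.prodMk hsnd) (Prod.ext inv_one rfl)
  exact (hZ.bundle.smooth_proj.comp_smoothAt (hN.smoothAt_inv (hN.smoothAt_mul hSn hωinv))).congr
    (Eventually.of_forall fun y => (inv_fst hω y (hmkn y)).symm)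

theorem smoothAt_conj_mk_one (g : G)
    (hωg : AG.SmoothAt AN (fun x => ω g x * (ω (g * x * g⁻¹) g)⁻¹) 1) :
    (prodSmooth S Aad).SmoothAt (prodSmooth S Aad) (MulAut.conj (⟨1, g⟩ : GS S)) 1 := by
  obtain ⟨hfst, hsnd⟩ := smoothAt_prodSmooth.1 ((prodSmooth S Aad).smoothAt_id 1)
  obtain ⟨n, hn, hmkn⟩ := hZ.bundle.exists_lift hfst
  refine smoothAt_prodSmooth.2
    ⟨?_, hG.smoothAt_mul_const g⁻¹ (hG.smoothAt_const_mul g hsnd)⟩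
  have hSn := (S.isC1sAut.diffeo g).1.comp_smoothAt hn
  have hωx := hωg.comp_of_eq hsnd one_snd
  exact (hZ.bundle.smooth_proj.comp_smoothAt (hN.smoothAt_mul hSn hωx)).congr
    (Eventually.of_forall fun y => (conj_fst hω g y (hmkn y)).symm)

theorem smoothAt_conj_incl (hωl : ∀ g, ω 1 g = 1) (hωr : ∀ g, ω g 1 = 1) (a : Nad N) :
    (prodSmooth S Aad).SmoothAt (prodSmooth S Aad) (MulAut.conj (incl S a)) 1 := by
  have hconst (b : Nad N) := (prodSmooth S Aad).smoothAt_const (prodSmooth S Aad) (incl S b) 1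
  have hleft : (prodSmooth S Aad).SmoothAt (prodSmooth S Aad) (fun x => incl S a * x) 1 := by
    refine smoothAt_mul hω hG hN hZ (hconst a) ((prodSmooth S Aad).smoothAt_id 1)
      (fun ν hν => (S.isC1sAut.diffeo 1).1.comp_smoothAt hν) ?_
    exact ((prodSmooth S Aad).smoothAt_const AN 1 1).congr
      (Eventually.of_forall fun x => (hωl x.snd).symm)
  refine (smoothAt_mul hω hG hN hZ hleft (hconst a⁻¹)
    (fun ν hν => S.isC1sAut.smoothAt_apply (smoothAt_prodSmooth.1 hleft).2 (one_mul _) hν)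
    ?_).congr (Eventually.of_forall fun x => ?_)
  · exact ((prodSmooth S Aad).smoothAt_const AN 1 1).congr
      (Eventually.of_forall fun x => (hωr (incl S a * x).snd).symm)
  · rw [map_inv, MulAut.conj_apply]

end Coordinates

theorem incl_mul_mk_one (a : Nad N) (g : G) : incl S a * ⟨1, g⟩ = ⟨a, g⟩ := by
  refine ext_rho ?_ (one_mul g)
  rw [rhoFun_mul]
  simp only [rhoFun, incl, MonoidHom.coe_mk, OneHom.coe_mk, S.isC1sAut.one, map_one, one_mul,
    mul_one]

theorem exists_localLieGroup (hG : IsLieGroup AG) (hN : IsLieGroup AN)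
    (hZ : IsSplitLieSubgroup AN (Subgroup.center N) AZ Aad) (S : OuterAction AG AN) :
    ∃ U : Set G, AG.Open U ∧ 1 ∈ U ∧ LocalLieGroup (prodSmooth S Aad) (proj S ⁻¹' U) := by
  obtain ⟨ω, hωs, hω'⟩ := S.exists_omega
  have hω : ∀ g g', S.delta g g' = MulAut.conj (ω g g') := hω'
  obtain ⟨W, hW, h1W, hωW⟩ := hωs.exists_open_smoothAt
  have hdiv : (AG.prod AG).SmoothAt AG (fun p => p.1 * p.2⁻¹) (1, 1) :=
    hG.smoothAt_mul (AG.smoothAt_fst AG _) (hG.smoothAt_inv (AG.smoothAt_snd AG (1, 1)))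
  obtain ⟨U, hU, h1U, hUW⟩ := exists_open_mul_inv_mem hdiv hW h1W
  have hid := (prodSmooth S Aad).smoothAt_id
  have hsnd : (prodSmooth S Aad).Map AG (proj S) :=
    map_iff.2 fun x => (smoothAt_prodSmooth.1 (hid x)).2
  refine ⟨U ∩ W, hU.inter hW, ⟨h1U, h1W⟩, Smooth.Open.preimage hsnd (hU.inter hW), ⟨h1U, h1W⟩,
    fun k x hx hkx => ?_, ?_, smoothAt_inv hω hG hN hZ (hωW 1 h1W 1 h1W), fun ⟨a, g⟩ => ?_⟩
  · have hkW : k.snd ∈ W := by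
      have hkx' := hUW _ hkx.1 _ hx.1
      rwa [map_mul, mul_inv_cancel_right] at hkx'
    exact smoothAt_mul hω hG hN hZ (Smooth.smoothAt_const _ _ k x) (hid x)
      (fun ν hν => (S.isC1sAut.diffeo k.snd).1.comp_smoothAt hν)
      ((hωW _ hkW _ hx.2).comp_of_eq
        ((Smooth.smoothAt_const _ _ k.snd x).prodMk (hsnd.smoothAt x)) rfl)
  · have hfst := (prodSmooth S Aad).smoothAt_fst (prodSmooth S Aad) (1, 1)
    have hsnd := (prodSmooth S Aad).smoothAt_snd (prodSmooth S Aad) (1, 1)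
    rw [smoothAt_prodSmooth] at hfst hsnd
    exact smoothAt_mul hω hG hN hZ (Smooth.smoothAt_fst _ _ _) (Smooth.smoothAt_snd _ _ _)
      (fun ν hν => S.isC1sAut.smoothAt_apply hfst.2 rfl hν)
      ((hωW 1 h1W 1 h1W).comp_of_eq (hfst.2.prodMk hsnd.2) rfl)
  · rw [← incl_mul_mk_one]
    exact smoothAt_conj_mul (smoothAt_conj_incl hω hG hN hZ hωs.one_left hωs.one_right a)
      (smoothAt_conj_mk_one hω hG hN hZ g (hωs.strongly g))

theorem exists_isNatural (hG : IsLieGroup AG) (hN : IsLieGroup AN)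
    (hZ : IsSplitLieSubgroup AN (Subgroup.center N) AZ Aad) (S : OuterAction AG AN) :
    ∃ L : Smooth 𝕜 (GS S), IsNatural S Aad L := by
  obtain ⟨U, hU, h1U, h⟩ := exists_localLieGroup hG hN hZ S
  have hV : h.leftInvariant.Open (proj S ⁻¹' U) := h.isOpen_of_subset h.isOpen subset_rfl
  refine ⟨h.leftInvariant, h.isLieGroup, U, hU, h1U, hV,
    (mapOn_iff (Aad.open_univ.prod hU)).2 fun p hp => ?_, (mapOn_iff hV).2 fun x hx => ?_⟩
  · have hmk : (Aad.prod AG).SmoothAt (prodSmooth S Aad) (prodEquiv S) p :=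
      ((Aad.prod AG).map_congr (prodEquiv S)).smoothAt p
    exact (h.smoothAt_id_leftInvariant hp.2).comp_of_eq hmk rfl
  · have hcomp := smoothAt_prodSmooth.1 (h.leftInvariant_smoothAt_id hx)
    exact hcomp.1.prodMk hcomp.2

end GS

end Natural

/-! ### The extension of `G^S` by `Z(N)` defined by an extension of `G` by `N` -/

section Gamma

variable {𝕜 : Type v} [RCLike 𝕜] {G N M : Type u} [Group G] [Group N]
  {AG : Smooth 𝕜 G} {AN : Smooth 𝕜 N} {AZ : Smooth 𝕜 (Subgroup.center N)}
  {Aad : Smooth 𝕜 (Nad N)} {C : Smooth 𝕜 M} {S : OuterAction AG AN} {L : Smooth 𝕜 (GS S)}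

namespace GS

theorem rho_mk (n : N) (g : G) : rho S ⟨n, g⟩ = MulAut.conj n * S g :=
  rfl

theorem rho_incl (n : N) : rho S (incl S n) = MulAut.conj n :=
  (rho_mk n 1).trans (by rw [S.isC1sAut.one, mul_one])

theorem smoothAt_rho (hN : IsLieGroup AN) (x : GS S) (n : N) : AN.SmoothAt AN (rho S x) n := by
  obtain ⟨a, g⟩ := x
  obtain ⟨m, rfl⟩ := QuotientGroup.mk_surjective a
  exact hN.smoothAt_mul_const m⁻¹ (hN.smoothAt_const_mul m ((S.isC1sAut.diffeo g).1.smoothAt n))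

theorem rho_eq_of_mem_center (x : GS S) {z : N} (hz : z ∈ Subgroup.center N) :
    rho S x z = S x.snd z := by
  obtain ⟨a, g⟩ := x
  obtain ⟨m, rfl⟩ := QuotientGroup.mk_surjective a
  have hSz : S g z ∈ Subgroup.center N := (Subgroup.centerCongr (S g) ⟨z, hz⟩).2
  rw [rho_mk, MulAut.mul_apply, MulAut.conj_apply, Subgroup.mem_center_iff.1 hSz m,
    mul_inv_cancel_right]

namespace IsNatural

theorem smoothAt_one (hL : IsNatural S Aad L) :
    L.SmoothAt (Aad.prod AG) (fun x => (x.fst, x.snd)) 1 := by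
  obtain ⟨U, -, h1U, hU, -, h⟩ := hL.product
  exact (mapOn_iff hU).1 h 1 h1U

theorem smoothAt_of_eq_one (hL : IsNatural S Aad L) {f : M → GS S} {x : M}
    (hfst : C.SmoothAt Aad (fun y => (f y).fst) x) (hsnd : C.SmoothAt AG (fun y => (f y).snd) x)
    (hx : f x = 1) : C.SmoothAt L f x := by
  obtain ⟨U, hU, h1U, -, h, -⟩ := hL.product
  exact ((mapOn_iff (Aad.open_univ.prod hU)).1 h (1, 1) ⟨mem_univ _, h1U⟩).comp_of_eq
    (hfst.prodMk hsnd) (by rw [hx, one_fst, one_snd])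

theorem map_proj (hL : IsNatural S Aad L) (hG : IsLieGroup AG) : L.Map AG (proj S) :=
  hL.lie.map_of_smoothAt_one hG hL.smoothAt_one.snd

/-- On `Z(N)` the action `ρ` is given by `S`, which is smooth near `1`; homogeneity does the
rest. -/
theorem map_rhoZ (hL : IsNatural S Aad L) (hN : IsLieGroup AN) (hG : IsLieGroup AG)
    (hZ : IsSplitLieSubgroup AN (Subgroup.center N) AZ Aad) :
    (L.prod AZ).Map AZ (fun p => rhoZ S p.1 p.2) := by
  refine map_iff.2 fun ⟨x, z⟩ => hZ.bundle.isInitial hZ.lie ?_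
  have hquot : (L.prod AZ).SmoothAt AG (fun p => x.snd⁻¹ * proj S p.1) (x, z) :=
    hG.smoothAt_const_mul _ ((hL.map_proj hG).comp_smoothAt (L.smoothAt_fst AZ (x, z)))
  have hcoe : (L.prod AZ).SmoothAt AN (fun p => (p.2 : N)) (x, z) :=
    hZ.bundle.smooth_incl.comp_smoothAt (L.smoothAt_snd AZ (x, z))
  have hS := S.isC1sAut.smoothAt_apply hquot (inv_mul_cancel _) hcoe
  refine ((smoothAt_rho hN x _).comp hS).congr (Eventually.of_forall fun p => ?_)
  have hρ : S (x.snd⁻¹ * proj S p.1) p.2 = rho S (x⁻¹ * p.1) p.2 :=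
    (rho_eq_of_mem_center (x⁻¹ * p.1) p.2.2).symm
  rw [hρ, ← MulAut.mul_apply, ← map_mul, mul_inv_cancel_left]
  rfl

end IsNatural

end GS

namespace LieExt

theorem conjN_eq_iff (E : LieExt AG AN) (x : E.carrier) (n m : N) :
    E.conjN x n = m ↔ x * E.ι n * x⁻¹ = E.ι m := by
  rw [← E.ι_conjN, E.ι_injective.eq_iff]

theorem conjN_ι (E : LieExt AG AN) (n : N) : E.conjN (E.ι n) = MulAut.conj n := by
  ext m
  rw [conjN_eq_iff, MulAut.conj_apply, map_mul, map_mul, map_inv]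

theorem CorrespondsTo.exists_section {E : LieExt AG AN} {R : G → MulAut N}
    (hE : E.CorrespondsTo R) :
    ∃ σ : G → E.carrier, AG.SmoothAt E.str σ 1 ∧ (∀ g, E.q (σ g) = g) ∧
      ∀ g, E.conjN (σ g) = R g := by
  obtain ⟨σ, hσ, hqσ, h, hh, hσR⟩ := hE
  refine ⟨fun g => (E.ι (h g))⁻¹ * σ g, ?_, fun g => ?_, fun g => ?_⟩
  · exact E.isExt.lie_mid.smoothAt_mul
      (E.isExt.lie_mid.smoothAt_inv (E.isExt.bundle.smooth_incl.comp_smoothAt hh.2)) hσ.2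
  · rw [map_mul, map_inv, E.isExt.q_ι, hqσ, inv_one, one_mul]
  · rw [map_mul, map_inv, conjN_ι, inv_mul_eq_iff_eq_mul]
    exact hσR g

theorem conjN_mul_inv_mem {E : LieExt AG AN} {R : G → MulAut N} (hE : E.CorrespondsTo R)
    (x : E.carrier) : E.conjN x * (R (E.q x))⁻¹ ∈ (MulAut.conj : N →* MulAut N).range := by
  obtain ⟨σ, -, hqσ, hσ⟩ := hE.exists_section
  obtain ⟨n, hn⟩ : x * (σ (E.q x))⁻¹ ∈ E.ι.range := by
    rw [E.isExt.exact, MonoidHom.mem_ker, map_mul, map_inv, hqσ, mul_inv_cancel]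
  exact ⟨n, by rw [← E.conjN_ι, hn, map_mul, map_inv, hσ]⟩

/-- The map underlying `γ : E → G^S`. -/
noncomputable def gammaFun (E : LieExt AG AN) (hE : E.CorrespondsTo S) (x : E.carrier) : GS S :=
  ⟨(adIso N).symm ⟨_, conjN_mul_inv_mem hE x⟩, E.q x⟩

theorem rhoFun_gammaFun (E : LieExt AG AN) (hE : E.CorrespondsTo S) (x : E.carrier) :
    GS.rhoFun (E.gammaFun hE x) = E.conjN x := by
  rw [GS.rhoFun, gammaFun, ad_adIso_symm, inv_mul_cancel_right]

/-- The homomorphism `γ = (C_N · (S ∘ q)⁻¹, q) : E → G^S`. -/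
noncomputable def gamma (E : LieExt AG AN) (hE : E.CorrespondsTo S) : E.carrier →* GS S :=
  MonoidHom.mk' (E.gammaFun hE) fun x y => GS.ext_rho
    (by rw [GS.rhoFun_mul, rhoFun_gammaFun, rhoFun_gammaFun, rhoFun_gammaFun, map_mul])
    (map_mul E.q x y)

theorem toAutProd_gamma (E : LieExt AG AN) (hE : E.CorrespondsTo S) (x : E.carrier) :
    GS.toAutProd S (E.gamma hE x) = E.gammaMap S x :=
  Prod.ext (ad_adIso_symm _) rfl

theorem rho_gamma (E : LieExt AG AN) (hE : E.CorrespondsTo S) (x : E.carrier) :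
    GS.rho S (E.gamma hE x) = E.conjN x :=
  E.rhoFun_gammaFun hE x

theorem gamma_eq_iff (E : LieExt AG AN) (hE : E.CorrespondsTo S) {x : E.carrier} {y : GS S} :
    E.gamma hE x = y ↔ E.conjN x = GS.rho S y ∧ E.q x = y.snd := by
  refine ⟨?_, fun h => GS.ext_rho ((E.rho_gamma hE x).trans h.1) h.2⟩
  rintro rfl
  exact ⟨(E.rho_gamma hE x).symm, rfl⟩

theorem gamma_ι (E : LieExt AG AN) (hE : E.CorrespondsTo S) (n : N) :
    E.gamma hE (E.ι n) = GS.incl S n :=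
  (E.gamma_eq_iff hE).2 ⟨by rw [conjN_ι, GS.rho_incl], E.isExt.q_ι n⟩

theorem ker_gamma (E : LieExt AG AN) (hE : E.CorrespondsTo S) :
    (E.gamma hE).ker = E.centerImage := by
  ext x
  rw [MonoidHom.mem_ker, gamma_eq_iff, map_one, centerImage, ← ker_conj]
  constructor
  · rintro ⟨hconj, hq⟩
    obtain ⟨n, rfl⟩ := E.isExt.exact.ge hq
    exact ⟨n, by rwa [conjN_ι] at hconj, rfl⟩
  · rintro ⟨n, hn, rfl⟩
    exact ⟨by rwa [conjN_ι], E.isExt.q_ι n⟩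

theorem range_ι_comp_subtype (E : LieExt AG AN) :
    (E.ι.comp (Subgroup.center N).subtype).range = E.centerImage := by
  rw [MonoidHom.range_comp, Subgroup.range_subtype, centerImage]

theorem smoothAt_gamma_one (hL : GS.IsNatural S Aad L)
    (hZ : IsSplitLieSubgroup AN (Subgroup.center N) AZ Aad) (E : LieExt AG AN)
    (hE : E.CorrespondsTo S) : E.str.SmoothAt L (E.gamma hE) 1 := by
  obtain ⟨σ, hσ, hqσ, hσS⟩ := hE.exists_section
  obtain ⟨hN, hlie, -, -, hbundle⟩ := E.isExt
  have hq : E.str.SmoothAt AG E.q 1 := hbundle.smooth_proj.smoothAt 1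
  have hσq : E.str.SmoothAt E.str (fun x => σ (E.q x)) 1 := hσ.comp_of_eq hq (map_one E.q)
  obtain ⟨n, hn, hxn⟩ := hbundle.exists_smoothAt_eq_mul hN (hlie.smoothAt_inv hσq)
    (hlie.smoothAt_inv (E.str.smoothAt_id 1)) fun x => by rw [map_inv, map_inv, hqσ]
  have hx (x : E.carrier) : x = E.ι (n x)⁻¹ * σ (E.q x) := by
    rw [map_inv, ← inv_inj, mul_inv_rev, inv_inv, hxn]
  have hγ (x : E.carrier) : E.gamma hE x = ⟨((n x)⁻¹ : N), E.q x⟩ := by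
    refine (E.gamma_eq_iff hE).2 ⟨?_, rfl⟩
    rw [GS.rho_mk, ← hσS, ← E.conjN_ι, ← map_mul, ← hx]
  refine hL.smoothAt_of_eq_one ?_ hq (map_one _)
  simp only [hγ]
  exact hZ.bundle.smooth_proj.comp_smoothAt (hN.smoothAt_inv hn)

theorem exists_gamma_section (hL : GS.IsNatural S Aad L)
    (hZ : IsSplitLieSubgroup AN (Subgroup.center N) AZ Aad) (E : LieExt AG AN)
    (hE : E.CorrespondsTo S) :
    ∃ s : GS S → E.carrier, L.SmoothAt E.str s 1 ∧ ∀ x, E.gamma hE (s x) = x := by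
  obtain ⟨σ, hσ, hqσ, hσS⟩ := hE.exists_section
  obtain ⟨n, hn, hmkn⟩ := hZ.bundle.exists_lift hL.smoothAt_one.fst
  refine ⟨fun x => E.ι (n x) * σ x.snd, ?_, fun x => (E.gamma_eq_iff hE).2 ⟨?_, ?_⟩⟩
  · exact E.isExt.lie_mid.smoothAt_mul (E.isExt.bundle.smooth_incl.comp_smoothAt hn)
      (hσ.comp_of_eq hL.smoothAt_one.snd rfl)
  · rw [map_mul, conjN_ι, hσS, ← GS.rho_mk, hmkn]
  · rw [map_mul, E.isExt.q_ι, hqσ, one_mul]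

theorem isLieExtension_gamma (hL : GS.IsNatural S Aad L)
    (hZ : IsSplitLieSubgroup AN (Subgroup.center N) AZ Aad) (E : LieExt AG AN)
    (hE : E.CorrespondsTo S) :
    IsLieExtension AZ E.str L (E.ι.comp (Subgroup.center N).subtype) (E.gamma hE) := by
  obtain ⟨s, hs, hγs⟩ := E.exists_gamma_section hL hZ hE
  exact .of_section hZ.lie E.isExt.lie_mid hL.lie
    (E.range_ι_comp_subtype.trans (E.ker_gamma hE).symm) (E.ι_injective.comp Subtype.val_injective)
    (E.isExt.bundle.smooth_incl.comp hZ.bundle.smooth_incl)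
    (E.isExt.isInitial.comp (hZ.bundle.isInitial hZ.lie))
    (E.isExt.lie_mid.map_of_smoothAt_one hL.lie (E.smoothAt_gamma_one hL hZ hE)) hs hγs

/-- The extension `γ : E → G^S` by `Z(N)` defined by an extension `E` of `G` by `N`. -/
noncomputable abbrev gammaExt (hL : GS.IsNatural S Aad L)
    (hZ : IsSplitLieSubgroup AN (Subgroup.center N) AZ Aad) (E : LieExt AG AN)
    (hE : E.CorrespondsTo S) : LieExt L AZ :=
  E.overGS (E.gamma hE) (E.isLieExtension_gamma hL hZ hE)

theorem exists_quotient_diffeo (hL : GS.IsNatural S Aad L)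
    (hZ : IsSplitLieSubgroup AN (Subgroup.center N) AZ Aad) (E : LieExt AG AN)
    (hE : E.CorrespondsTo S) :
    ∃ (K : Smooth 𝕜 E.centerImage) (Q : Smooth 𝕜 (E.carrier ⧸ E.centerImage))
      (e : E.carrier ⧸ E.centerImage ≃* GS S),
      IsSplitLieSubgroup E.str E.centerImage K Q ∧ Q.Diffeo L e.toEquiv ∧
      ∀ x : E.carrier, e (x : E.carrier ⧸ E.centerImage) = E.gamma hE x :=
  have h := E.isLieExtension_gamma hL hZ hE
  have hK := E.range_ι_comp_subtype
  ⟨_, _, h.quotientEquiv hK, h.isSplitLieSubgroup hK, (L.diffeo_congr _).symm,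
    h.quotientEquiv_mk hK⟩

theorem correspondsTo_of_conjN_eq {E : LieExt AG AN} {R : G → MulAut N}
    (h : ∀ x, E.conjN x = R (E.q x)) : E.CorrespondsTo R := by
  obtain ⟨σ, hσ, hqσ⟩ := E.isExt.exists_section
  refine ⟨σ, hσ, hqσ, fun _ => 1, ⟨rfl, AG.smoothAt_const AN 1 1⟩, fun g => ?_⟩
  rw [map_one, one_mul]
  exact (h _).trans (congrArg R (hqσ g))

theorem gammaExt_correspondsTo (hL : GS.IsNatural S Aad L)
    (hZ : IsSplitLieSubgroup AN (Subgroup.center N) AZ Aad) (E : LieExt AG AN)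
    (hE : E.CorrespondsTo S) : (E.gammaExt hL hZ hE).CorrespondsTo (GS.rhoZ S) := by
  refine correspondsTo_of_conjN_eq fun x => ?_
  ext1 z
  rw [conjN_eq_iff]
  change x * E.ι z * x⁻¹ = E.ι (GS.rho S (E.gamma hE x) z)
  rw [rho_gamma, ι_conjN]

namespace Equivalent

theorem refl (E : LieExt AG AN) : E.Equivalent E :=
  ⟨MonoidHom.id _, map_iff.2 E.str.smoothAt_id, rfl, rfl⟩

theorem symm {E₁ E₂ : LieExt AG AN} (h : E₁.Equivalent E₂) : E₂.Equivalent E₁ := by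
  obtain ⟨φ, hφ⟩ := h
  obtain ⟨e, heφ, he⟩ := hφ.exists_diffeo E₁.isExt E₂.isExt
  refine ⟨e.symm.toMonoidHom, he.2, MonoidHom.ext fun n => ?_, MonoidHom.ext fun y => ?_⟩
  · exact e.symm_apply_eq.2 ((heφ _).trans (hφ.apply_ι n)).symm
  · exact (hφ.q_apply _).symm.trans (congrArg E₂.q ((heφ _).symm.trans (e.apply_symm_apply y)))

theorem trans {E₁ E₂ E₃ : LieExt AG AN} (h₁₂ : E₁.Equivalent E₂) (h₂₃ : E₂.Equivalent E₃) :
    E₁.Equivalent E₃ := by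
  obtain ⟨φ, hφ⟩ := h₁₂
  obtain ⟨ψ, hψ⟩ := h₂₃
  refine ⟨ψ.comp φ, hψ.smooth.comp hφ.smooth, ?_, ?_⟩
  · rw [MonoidHom.comp_assoc, hφ.comp_left, hψ.comp_left]
  · rw [← MonoidHom.comp_assoc, hψ.comp_right, hφ.comp_right]

theorem gammaExt (hL : GS.IsNatural S Aad L)
    (hZ : IsSplitLieSubgroup AN (Subgroup.center N) AZ Aad) {E₁ E₂ : LieExt AG AN}
    (h : E₁.Equivalent E₂) (hE₁ : E₁.CorrespondsTo S) (hE₂ : E₂.CorrespondsTo S) :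
    (E₁.gammaExt hL hZ hE₁).Equivalent (E₂.gammaExt hL hZ hE₂) := by
  obtain ⟨φ, hφ⟩ := h
  refine ⟨φ, hφ.smooth, MonoidHom.ext fun z => hφ.apply_ι z, MonoidHom.ext fun x => ?_⟩
  refine (E₂.gamma_eq_iff hE₂).2 ⟨?_, hφ.q_apply x⟩
  rw [rho_gamma]
  ext n
  rw [conjN_eq_iff, ← hφ.apply_ι, ← hφ.apply_ι, ι_conjN, map_mul, map_mul, map_inv]

end Equivalent

theorem Ext.mk_eq_mk {R : G → MulAut N} {E₁ E₂ : WithKernel AG AN R} :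
    (Quot.mk _ E₁ : Ext AG AN R) = Quot.mk _ E₂ ↔ E₁.1.Equivalent E₂.1 := by
  have h : Equivalence fun E₁ E₂ : WithKernel AG AN R => Equivalent E₁.1 E₂.1 :=
    ⟨fun E => .refl E.1, .symm, .trans⟩
  exact ⟨fun h' => h.eqvGen_iff.1 (Quot.eqvGen_exact h'), fun h' => Quot.sound h'⟩

/-- The map `τ : Ext(G,N)_{[S]} → Ext(G^S,Z(N))_{[ρ]}`. -/
noncomputable def tau (hL : GS.IsNatural S Aad L)
    (hZ : IsSplitLieSubgroup AN (Subgroup.center N) AZ Aad) :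
    Ext AG AN S → Ext L AZ (GS.rhoZ S) :=
  Quot.map (fun E => ⟨E.1.gammaExt hL hZ E.2, E.1.gammaExt_correspondsTo hL hZ E.2⟩)
    fun E₁ E₂ h => h.gammaExt hL hZ E₁.2 E₂.2

end LieExt

end Gamma

/-! ### The image of `τ` -/

section Image

variable {𝕜 : Type v} [RCLike 𝕜] {G N : Type u} [Group G] [Group N]
  {AG : Smooth 𝕜 G} {AN : Smooth 𝕜 N} {AZ : Smooth 𝕜 (Subgroup.center N)}
  {Aad : Smooth 𝕜 (Nad N)} {S : OuterAction AG AN} {L : Smooth 𝕜 (GS S)}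

namespace GS

theorem range_incl : (incl S).range = (proj S).ker := by
  ext x
  exact ⟨fun ⟨_, ha⟩ => ha ▸ rfl, fun hx => ⟨x.fst, GS.ext rfl (Eq.symm hx)⟩⟩

end GS

namespace LieExt

theorem preNad_eq_ker (F : LieExt L AZ) : F.preNad = ((GS.proj S).comp F.q).ker := by
  rw [preNad, GS.range_incl, MonoidHom.comap_ker]

instance (F : LieExt L AZ) : F.preNad.Normal := by
  rw [preNad_eq_ker]
  infer_instance

theorem exists_section_mk_one (F : LieExt L AZ) (hL : GS.IsNatural S Aad L) :
    ∃ σ : G → F.carrier, IsC1s AG F.str σ ∧ ∀ g, F.q (σ g) = ⟨1, g⟩ := by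
  obtain ⟨s, ⟨hs1, hs⟩, hqs⟩ := F.isExt.exists_section
  have hmk : AG.SmoothAt L (fun g => (⟨1, g⟩ : GS S)) 1 :=
    hL.smoothAt_of_eq_one (AG.smoothAt_const Aad 1 1) (AG.smoothAt_id 1) rfl
  exact ⟨fun g => s ⟨1, g⟩, ⟨hs1, Smooth.SmoothAt.comp_of_eq hs hmk rfl⟩, fun g => hqs _⟩

/-- The embedding `ι : N → F` makes an extension `F` of `G^S` by `Z(N)` an extension of `G` by `N`,
restricts to the given embedding of `Z(N)`, and is equivariant for the action `ρ` on `N` and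
conjugation in `F`. It plays the role of `α : N → γ⁻¹(N_ad) ⊆ F`. -/
structure IsEquivariantEmbedding (F : LieExt L AZ) (ι : N →* F.carrier) : Prop where
  isExt : IsLieExtension AN F.str AG ι ((GS.proj S).comp F.q)
  apply_center : ∀ z : Subgroup.center N, ι z = F.ι z
  equivariant : ∀ x n, ι (GS.rho S (F.q x) n) = x * ι n * x⁻¹

namespace IsEquivariantEmbedding

variable {F : LieExt L AZ} {ι : N →* F.carrier}

/-- The extension of `G` by `N` with total group `F` defined by an equivariant embedding of `N`. -/
noncomputable abbrev toLieExt (h : F.IsEquivariantEmbedding ι) : LieExt AG AN where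
  carrier := F.carrier
  str := F.str
  ι := ι
  q := (GS.proj S).comp F.q
  isExt := h.isExt

theorem conjN_toLieExt (h : F.IsEquivariantEmbedding ι) (x : F.carrier) :
    h.toLieExt.conjN x = GS.rho S (F.q x) := by
  ext n
  exact (h.toLieExt.conjN_eq_iff x _ _).2 (h.equivariant x n).symm

theorem toLieExt_correspondsTo (h : F.IsEquivariantEmbedding ι) (hL : GS.IsNatural S Aad L) :
    h.toLieExt.CorrespondsTo S := by
  obtain ⟨σ, hσ, hqσ⟩ := F.exists_section_mk_one hL
  refine ⟨σ, hσ, fun g => congrArg (GS.proj S) (hqσ g), fun _ => 1,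
    ⟨rfl, AG.smoothAt_const AN 1 1⟩, fun g => ?_⟩
  dsimp only
  rw [conjN_toLieExt, hqσ]
  exact GS.rho_mk 1 g

theorem gamma_toLieExt (h : F.IsEquivariantEmbedding ι) (hE : h.toLieExt.CorrespondsTo S)
    (x : F.carrier) : h.toLieExt.gamma hE x = F.q x :=
  (h.toLieExt.gamma_eq_iff hE).2 ⟨h.conjN_toLieExt x, rfl⟩

theorem q_ι (h : F.IsEquivariantEmbedding ι) (hL : GS.IsNatural S Aad L) (n : N) :
    F.q (ι n) = GS.incl S n := by
  have hE := h.toLieExt_correspondsTo hL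
  rw [← h.gamma_toLieExt hE]
  exact h.toLieExt.gamma_ι hE n

theorem gammaExt_toLieExt_equivalent (h : F.IsEquivariantEmbedding ι)
    (hL : GS.IsNatural S Aad L) (hZ : IsSplitLieSubgroup AN (Subgroup.center N) AZ Aad) :
    (h.toLieExt.gammaExt hL hZ (h.toLieExt_correspondsTo hL)).Equivalent F :=
  ⟨MonoidHom.id _, map_iff.2 F.str.smoothAt_id, MonoidHom.ext h.apply_center,
    MonoidHom.ext fun x => (h.gamma_toLieExt _ x).symm⟩

theorem correspondsTo_rhoZ (h : F.IsEquivariantEmbedding ι) : F.CorrespondsTo (GS.rhoZ S) := by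
  refine correspondsTo_of_conjN_eq fun x => ?_
  ext1 z
  rw [conjN_eq_iff, ← h.apply_center, ← h.apply_center, GS.rhoZ_apply, h.equivariant]

theorem hasEquivariantEquiv (h : F.IsEquivariantEmbedding ι) (hL : GS.IsNatural S Aad L)
    (hZ : IsSplitLieSubgroup AN (Subgroup.center N) AZ Aad) : F.HasEquivariantEquiv AN Aad := by
  have hK : ι.range = F.preNad := h.isExt.exact.trans F.preNad_eq_ker.symm
  let α : N ≃* F.preNad := h.isExt.kernelEquiv hK
  have hα := AN.diffeo_congr α.toEquiv
  have hαι (z : Subgroup.center N) : F.preNadι z = α z := Subtype.ext (h.apply_center z).symm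
  have hαq (n : N) : F.preNadProj (α n) = n := congrArg GS.fst (h.q_ι hL n)
  refine ⟨AN.congr α.toEquiv, _, h.isExt.isSplitLieSubgroup hK,
    (hZ.isLieExtension h.isExt.lie_left).congr hα hαι hαq, ?_, α.toMonoidHom,
    ⟨hα.1, MonoidHom.ext fun z => (hαι z).symm, MonoidHom.ext hαq⟩, h.equivariant⟩
  rintro _ ⟨z, rfl⟩
  rw [Subgroup.mem_center_iff]
  intro x
  obtain ⟨n, rfl⟩ := α.surjective x
  rw [hαι, ← map_mul, ← map_mul, Subgroup.mem_center_iff.1 z.2 n]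

end IsEquivariantEmbedding

theorem HasEquivariantEquiv.exists_isEquivariantEmbedding {F : LieExt L AZ}
    (h : F.HasEquivariantEquiv AN Aad) (hL : GS.IsNatural S Aad L) (hG : IsLieGroup AG)
    (hN : IsLieGroup AN) (hZ : IsSplitLieSubgroup AN (Subgroup.center N) AZ Aad) :
    ∃ ι : N →* F.carrier, F.IsEquivariantEmbedding ι := by
  obtain ⟨P, Q, hP, hext, -, α, hα, hequiv⟩ := h
  obtain ⟨e, heα, he⟩ := hα.exists_diffeo (hZ.isLieExtension hN) hext
  obtain ⟨σ, ⟨-, hσ⟩, hqσ⟩ := F.exists_section_mk_one hL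
  refine ⟨F.preNad.subtype.comp α, ?_, fun z => congrArg Subtype.val (hα.apply_ι z), hequiv⟩
  have hαe : (e : N → F.preNad) = α := funext heα
  have hαbij : Function.Bijective α := hαe ▸ e.bijective
  have hαin : IsInitial AN P α := hαe ▸ .of_diffeo he
  refine .of_section hN F.isExt.lie_mid hG ?_ (Subtype.val_injective.comp hαbij.1)
    (hP.bundle.smooth_incl.comp hα.smooth) ((hP.bundle.isInitial hP.lie).comp hαin)
    ((hL.map_proj hG).comp F.isExt.bundle.smooth_proj) hσ
    fun g => congrArg (GS.proj S) (hqσ g)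
  rw [MonoidHom.range_comp, MonoidHom.range_eq_top.2 hαbij.2, ← MonoidHom.range_eq_map,
    Subgroup.range_subtype, preNad_eq_ker]

theorem exists_isEquivariantEmbedding (hL : GS.IsNatural S Aad L)
    (hZ : IsSplitLieSubgroup AN (Subgroup.center N) AZ Aad) {E : LieExt AG AN}
    (hE : E.CorrespondsTo S) {F : LieExt L AZ} (h : (E.gammaExt hL hZ hE).Equivalent F) :
    ∃ ι : N →* F.carrier, F.IsEquivariantEmbedding ι := by
  obtain ⟨φ, hφ⟩ := h
  obtain ⟨e, heφ, he⟩ := hφ.exists_diffeo (E.isLieExtension_gamma hL hZ hE) F.isExt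
  have hq (x : E.carrier) : F.q (e x) = E.gamma hE x :=
    (congrArg F.q (heφ x)).trans (hφ.q_apply x)
  refine ⟨e.toMonoidHom.comp E.ι, E.isExt.congr he (fun _ => rfl) fun x => ?_,
    fun z => (heφ _).trans (hφ.apply_ι z), fun y n => ?_⟩
  · exact congrArg (GS.proj S) (hq x)
  · obtain ⟨x, rfl⟩ := e.surjective y
    change e (E.ι (GS.rho S (F.q (e x)) n)) = e x * e (E.ι n) * (e x)⁻¹
    rw [hq, rho_gamma, ι_conjN, map_mul, map_mul, map_inv]

theorem mem_range_tau_iff (hL : GS.IsNatural S Aad L) (hG : IsLieGroup AG) (hN : IsLieGroup AN)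
    (hZ : IsSplitLieSubgroup AN (Subgroup.center N) AZ Aad) (F : LieExt L AZ) :
    (∃ hF : F.CorrespondsTo (GS.rhoZ S), Quot.mk _ ⟨F, hF⟩ ∈ range (tau hL hZ)) ↔
      F.HasEquivariantEquiv AN Aad := by
  constructor
  · rintro ⟨hF, ⟨E⟩, hE⟩
    obtain ⟨ι, hι⟩ := exists_isEquivariantEmbedding hL hZ E.2 (Ext.mk_eq_mk.1 hE)
    exact hι.hasEquivariantEquiv hL hZ
  · intro h
    obtain ⟨ι, hι⟩ := h.exists_isEquivariantEmbedding hL hG hN hZ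
    exact ⟨hι.correspondsTo_rhoZ, Quot.mk _ ⟨hι.toLieExt, hι.toLieExt_correspondsTo hL⟩,
      Ext.mk_eq_mk.2 (hι.gammaExt_toLieExt_equivalent hL hZ)⟩

end LieExt

end Image

end LCLie

theorem mainTheorem7 {𝕜 : Type v} [RCLike 𝕜] {G N : Type u} [Group G] [Group N]
    (AG : LCLie.Smooth 𝕜 G) (AN : LCLie.Smooth 𝕜 N)
    (hG : LCLie.IsLieGroup AG) (hN : LCLie.IsLieGroup AN)
    (AZ : LCLie.Smooth 𝕜 (Subgroup.center N)) (Aad : LCLie.Smooth 𝕜 (LCLie.Nad N))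
    (hZ : LCLie.IsSplitLieSubgroup AN (Subgroup.center N) AZ Aad)
    (S : LCLie.OuterAction AG AN) :
    (∃ L : LCLie.Smooth 𝕜 (LCLie.GS S), LCLie.GS.IsNatural S Aad L) ∧
    ∀ L : LCLie.Smooth 𝕜 (LCLie.GS S), LCLie.GS.IsNatural S Aad L →
      (L.prod AZ).Map AZ (fun p => LCLie.GS.rhoZ S p.1 p.2) ∧
      ∃ γ : ∀ E : LCLie.LieExt.WithKernel AG AN S, E.1.carrier →* LCLie.GS S,
        (∀ E x, LCLie.GS.toAutProd S (γ E x) = E.1.gammaMap S x) ∧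
        (∀ E : LCLie.LieExt.WithKernel AG AN S,
          ∃ (K : LCLie.Smooth 𝕜 E.1.centerImage)
            (Q : LCLie.Smooth 𝕜 (E.1.carrier ⧸ E.1.centerImage))
            (e : E.1.carrier ⧸ E.1.centerImage ≃* LCLie.GS S),
            LCLie.IsSplitLieSubgroup E.1.str E.1.centerImage K Q ∧ Q.Diffeo L e.toEquiv ∧
            ∀ x : E.1.carrier, e (x : E.1.carrier ⧸ E.1.centerImage) = γ E x) ∧
        ∃ hγ : ∀ E, LCLie.IsLieExtension AZ E.1.str L
            (E.1.ι.comp (Subgroup.center N).subtype) (γ E),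
          ∃ hρ : ∀ E, (E.1.overGS (γ E) (hγ E)).CorrespondsTo (LCLie.GS.rhoZ S),
            (∀ E₁ E₂ : LCLie.LieExt.WithKernel AG AN S, E₁.1.Equivalent E₂.1 →
              (E₁.1.overGS (γ E₁) (hγ E₁)).Equivalent (E₂.1.overGS (γ E₂) (hγ E₂))) ∧
            ∃ τ : LCLie.LieExt.Ext AG AN S → LCLie.LieExt.Ext L AZ (LCLie.GS.rhoZ S),
              (∀ E, τ (Quot.mk _ E) = Quot.mk _ ⟨E.1.overGS (γ E) (hγ E), hρ E⟩) ∧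
              ∀ F : LCLie.LieExt L AZ,
                (∃ hF : F.CorrespondsTo (LCLie.GS.rhoZ S), Quot.mk _ ⟨F, hF⟩ ∈ Set.range τ) ↔
                  F.HasEquivariantEquiv AN Aad := by
  refine ⟨LCLie.GS.exists_isNatural hG hN hZ S, fun L hL => ⟨hL.map_rhoZ hN hG hZ,
    fun E => E.1.gamma E.2, fun E => E.1.toAutProd_gamma E.2,
    fun E => E.1.exists_quotient_diffeo hL hZ E.2,
    fun E => E.1.isLieExtension_gamma hL hZ E.2,
    fun E => E.1.gammaExt_correspondsTo hL hZ E.2,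
    fun E₁ E₂ h => h.gammaExt hL hZ E₁.2 E₂.2,
    LCLie.LieExt.tau hL hZ, fun _ => rfl, LCLie.LieExt.mem_range_tau_iff hL hG hN hZ⟩⟩
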